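/- **Theorem (Riesz representation theorem for $C_c(X)$: normed case).** *Conventions.* A partially ordered vector space $E$ is a real vector space with a partial order that is compatible with addition and with multiplication by non-negative scalars; $E^+=\{x\in E: x\geq 0\}$. It is monotone complete if every increasing net in $E$ that is bounded from above has a supremum. We write $x_\lambda\downarrow 0$ if $(x_\lambda)$ is a decreasing net with infimum $0$. A positive functional $x'$ on $E$ is $\sigma$-order continuous if $x_n\downarrow 0$ in $E$ implies $x'(x_n)\downarrow 0$ for all sequences $(x_n)$. Put $\overline E=E\cup\{\infty\}$, where $x\leq\infty$ and $x+\infty=\infty+x=\infty$ for all $x\in\overline E$, $r\cdot\infty=\infty$ for real $r>0$, and $0\cdot\infty=0$; put $\overline{E^+}=E^+\cup\{\infty\}$. Elements of $E$ are called finite. Let $X$ be a locally compact Hausdorff space with Borel $\sigma$-algebra $\mathcal B$. A positive $\overline E$-valued measure is a map $\mu:\mathcal B\to\overline{E^+}$ with $\mu(\emptyset)=0$ and $\mu(\bigcup_n\Delta_n)=\bigvee_{N}\sum_{n=1}^N\mu(\Delta_n)$ in $\overline E$ for every pairwise disjoint sequence $(\Delta_n)$ in $\mathcal B$. It is finite if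 $\mu(X)\in E$. It is a regular Borel measure if $\mu(K)\in E$ for all compact $K$, $\mu(V)=\bigvee\{\mu(K):K\subseteq V\text{ compact}\}$ for all open $V$, and $\mu(\Delta)=\bigwedge\{\mu(V):V\supseteq\Delta\text{ open}\}$ for all $\Delta\in\mathcal B$, with suprema and infima in $\overline E$. The order integral of an elementary function $\varphi=\sum_{i=1}^n r_i\mathbf 1_{\Delta_i}$ ($r_i\in[0,\infty)$, $\Delta_i\in\mathcal B$) is $\sum_i r_i\mu(\Delta_i)\in\overline{E^+}$. For measurable $f:X\to[0,\infty]$ it is $\bigvee_n\int\varphi_n\,\mathrm d\mu$ in $\overline E$, for any sequence of elementary functions $\varphi_n\uparrow f$ pointwise. For measurable $f:X\to\mathbb R$ such that the order integral of $|f|$ is finite it is $\int f^+\,\mathrm d\mu-\int f^-\,\mathrm d\mu\in E$. Let $C_c(X)$ be the space of real-valued continuous functions on $X$ with compact support, with the pointwise order and the supremum norm. For $f\in C_c(X)$ and $S\subseteq X$, $f\prec S$ means that $0\leq f\leq 1$ and $\operatorname{supp} f\subseteq S$; $S\prec f$ means that $0\leq f\leq 1$ and $f=1$ on $S$. *Statement.*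 Let $E$ be a monotone complete partially ordered vector space that is also a normed space, such that: 1. if $x_\lambda\downarrow 0$ in $E$, then $\|x_\lambda\|\to 0$; 2. if $(x_n)\subset E^+$ is such that $\sum_{n=1}^\infty\|x_n\|<\infty$, then the sequence of partial sums $\sum_{n=1}^N x_n$ has a supremum in $E$; 3. if $x\in E$ is such that $x'(x)\geq 0$ for all norm bounded positive $\sigma$-order continuous functionals $x'$ on $E$, then $x\in E^+$. Let $X$ be a non-empty locally compact Hausdorff space, and let $\pi:C_c(X)\to E$ be a positive linear operator. Then there exists a unique regular Borel measure $\mu:\mathcal B\to\overline{E^+}$ such that $$\pi(f)=\int_X f\,\mathrm d\mu\quad\text{(order integral) for all } f\in C_c(X).$$ If $V$ is a non-empty open subset of $X$, then $\mu(V)=\bigvee\{\pi(f): f\prec V\}$ in $\overline E$. If $K$ is a compact subset of $X$, then $\mu(K)=\bigwedge\{\pi(f): K\prec f\}$ in $\overline E$. The measure $\mu$ is finite if and only if $\{\pi(f): f\in C_c(X),\ f\geq 0,\ \|f\|\leq 1\}$ is bounded above in $E$; this is automatically the case if $X$ is compact. If $\mu$ is finite and the norm of $E$ is monotone on $E^+$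 (that is, $0\leq x\leq y$ implies $\|x\|\leq\|y\|$), then $\pi$ is continuous with respect to the supremum norm on $C_c(X)$ and the norm on $E$, and $\|\pi\|\leq 2\|\mu(X)\|$. If $E$ is a normed vector lattice (the order is a lattice order and $|x|\leq|y|$ implies $\|x\|\leq\|y\|$), then $E$ is a Banach lattice with an order continuous norm and, if $\mu$ is finite, $\pi$ is continuous with $\|\pi\|=\|\mu(X)\|$. -/

import Mathlib

open Filter Topology MeasureTheory Set
open scoped NNReal ENNReal CompactlySupported

namespace OrderRiesz

/-! ### Partially ordered vector spaces -/

/-- `E` is monotone complete: every increasing net in `E` that is bounded from above has a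
supremum. (It is enough to let the index sets of nets range over the universe of `E`, since every
monotone net can be replaced by its directed range.) -/
def MonotoneComplete.{u} (E : Type u) [PartialOrder E] : Prop :=
  ∀ (ι : Type u) [Preorder ι] [IsDirectedOrder ι] [Nonempty ι] (x : ι → E),
    Monotone x → BddAbove (range x) → ∃ s : E, IsLUB (range x) s

/-- `x_λ ↓ 0` in `E` implies `‖x_λ‖ → 0`, for all nets in `E`. -/
def NormOrderContinuous.{u} (E : Type u) [NormedAddCommGroup E] [PartialOrder E] : Prop :=
  ∀ (ι : Type u) [Preorder ι] [IsDirectedOrder ι] [Nonempty ι] (x : ι → E),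
    Antitone x → IsGLB (range x) 0 → Tendsto (fun i => ‖x i‖) atTop (𝓝 0)

/-- The functional `φ` is positive: it maps positive elements to positive elements. -/
def IsPositiveFunctional {E : Type*} [AddCommGroup E] [Module ℝ E] [PartialOrder E]
    (φ : E →ₗ[ℝ] ℝ) : Prop :=
  ∀ x : E, 0 ≤ x → 0 ≤ φ x

/-- The (positive) functional `φ` is `σ`-order continuous: `x_n ↓ 0` implies `φ x_n ↓ 0`. -/
def IsSigmaOrderContinuous {E : Type*} [AddCommGroup E] [Module ℝ E] [PartialOrder E]
    (φ : E →ₗ[ℝ] ℝ) : Prop :=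
  ∀ x : ℕ → E, Antitone x → IsGLB (range x) 0 →
    Antitone (fun n => φ (x n)) ∧ IsGLB (range fun n => φ (x n)) 0

/-- The given order and norm make `E` into a normed vector lattice: the order is a lattice order,
and `|x| ≤ |y|` implies `‖x‖ ≤ ‖y‖`. -/
def IsNormedVectorLattice (E : Type*) [NormedAddCommGroup E] [P : PartialOrder E] : Prop :=
  ∃ L : Lattice E, L.toPartialOrder = P ∧ HasSolidNorm E

/-- `E` is a Banach lattice with an order continuous norm. -/
def IsOrderContinuousBanachLattice (E : Type*) [NormedAddCommGroup E] [PartialOrder E] : Prop :=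
  IsNormedVectorLattice E ∧ CompleteSpace E ∧ NormOrderContinuous E

/-! ### Measures with values in the extended positive cone, and the order integral

The extended space `E ∪ {∞}` is `WithTop E`, with its usual order and addition. -/

/-- Multiplication of an element of the extended space by a nonnegative real number, with
`r · ∞ = ∞` for `r > 0` and `0 · ∞ = 0`. -/
noncomputable def extSMul {E : Type*} [AddCommGroup E] [Module ℝ E] (r : ℝ≥0) :
    WithTop E → WithTop E
  | ⊤ => if r = 0 then 0 else ⊤
  | (x : E) => (((r : ℝ) • x : E) : WithTop E)

/-- A positive measure on the `σ`-algebra of the measurable space `X`, with values in the extended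
positive cone of `E`. As for Mathlib's `VectorMeasure`, such a map on the `σ`-algebra is encoded
as a map on all subsets with the value `0` at the non-measurable ones. -/
structure PosMeasure (X E : Type*) [MeasurableSpace X] [AddCommGroup E] [PartialOrder E] where
  toFun : Set X → WithTop E
  nonneg' : ∀ s, 0 ≤ toFun s
  empty' : toFun ∅ = 0
  not_measurable' : ∀ s, ¬ MeasurableSet s → toFun s = 0
  sigma_additive' : ∀ s : ℕ → Set X, (∀ n, MeasurableSet (s n)) →
    Pairwise (fun i j => Disjoint (s i) (s j)) →
    IsLUB (range fun N : ℕ => ∑ n ∈ Finset.range N, toFun (s n)) (toFun (⋃ n, s n))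

instance {X E : Type*} [MeasurableSpace X] [AddCommGroup E] [PartialOrder E] :
    CoeFun (PosMeasure X E) (fun _ => Set X → WithTop E) :=
  ⟨PosMeasure.toFun⟩

section Integral

variable {X E : Type*} [MeasurableSpace X] [AddCommGroup E] [Module ℝ E] [PartialOrder E]

/-- The order integral `∑ r, r • μ {φ = r}` of an elementary function. -/
noncomputable def elementaryIntegral (μ : PosMeasure X E) (φ : SimpleFunc X ℝ≥0) : WithTop E :=
  ∑ r ∈ φ.range, extSMul r (μ (φ ⁻¹' {r}))

/-- `I` is the order integral of `f : X → [0, ∞]`: it is the supremum in the extended space of the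
order integrals of the members of an increasing sequence of elementary functions that converges
pointwise to `f`. -/
def HasPosOrderIntegral (μ : PosMeasure X E) (f : X → ℝ≥0∞) (I : WithTop E) : Prop :=
  ∃ φ : ℕ → SimpleFunc X ℝ≥0, Monotone φ ∧ (∀ x, ⨆ n, (φ n x : ℝ≥0∞) = f x) ∧
    IsLUB (range fun n => elementaryIntegral μ (φ n)) I

/-- The function `f : X → ℝ` is integrable with respect to `μ`, i.e., it is measurable and the
order integral of `|f|` is finite, and `y` is its order integral. -/
def HasOrderIntegral (μ : PosMeasure X E) (f : X → ℝ) (y : E) : Prop :=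
  Measurable f ∧
  (∃ c : E, HasPosOrderIntegral μ (fun x => ENNReal.ofReal |f x|) (c : WithTop E)) ∧
  ∃ a b : E, HasPosOrderIntegral μ (fun x => ENNReal.ofReal (f x)) (a : WithTop E) ∧
    HasPosOrderIntegral μ (fun x => ENNReal.ofReal (-f x)) (b : WithTop E) ∧ y = a - b

end Integral

section Regular

variable {X E : Type*} [TopologicalSpace X] [MeasurableSpace X] [AddCommGroup E] [PartialOrder E]

/-- `μ` is finite at all compact sets. -/
def IsBorelMeasure (μ : PosMeasure X E) : Prop :=
  ∀ K : Set X, IsCompact K → μ K ≠ ⊤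

/-- Inner regularity at `s`: `μ s` is the supremum of `μ K` for compact `K ⊆ s`. -/
def InnerRegularAt (μ : PosMeasure X E) (s : Set X) : Prop :=
  IsLUB {y : WithTop E | ∃ K : Set X, IsCompact K ∧ K ⊆ s ∧ y = μ K} (μ s)

/-- Outer regularity at `s`: `μ s` is the infimum of `μ V` for open `V ⊇ s`. -/
def OuterRegularAt (μ : PosMeasure X E) (s : Set X) : Prop :=
  IsGLB {y : WithTop E | ∃ V : Set X, IsOpen V ∧ s ⊆ V ∧ y = μ V} (μ s)

/-- A regular Borel measure is finite at compact sets, inner regular at open sets, and outer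
regular at Borel sets. -/
def IsRegularBorelMeasure (μ : PosMeasure X E) : Prop :=
  IsBorelMeasure μ ∧ (∀ V : Set X, IsOpen V → InnerRegularAt μ V) ∧
    ∀ s : Set X, MeasurableSet s → OuterRegularAt μ s

end Regular

/-! ### Compactly supported continuous functions -/

section Cc

variable {X : Type*} [TopologicalSpace X]

/-- `f ≺ S`: `0 ≤ f ≤ 1` and the support of `f` is contained in `S`. -/
def PrecSet (f : C_c(X, ℝ)) (S : Set X) : Prop :=
  (∀ x, 0 ≤ f x ∧ f x ≤ 1) ∧ tsupport f ⊆ S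

/-- `S ≺ f`: `0 ≤ f ≤ 1` and `f = 1` on `S`. -/
def SetPrec (S : Set X) (f : C_c(X, ℝ)) : Prop :=
  (∀ x, 0 ≤ f x ∧ f x ≤ 1) ∧ ∀ x ∈ S, f x = 1

/-- The inclusion of `C_c(X)` into the bounded continuous functions. -/
def toBCF : C_c(X, ℝ) →ₗ[ℝ] BoundedContinuousFunction X ℝ where
  toFun f := f.toBoundedContinuousFunction
  map_add' _ _ := rfl
  map_smul' _ _ := rfl

theorem toBCF_injective : Function.Injective (toBCF (X := X)) := fun f g h => by
  ext x
  exact congrArg (fun k : BoundedContinuousFunction X ℝ => k x) h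

/-- `C_c(X)` carries the supremum norm. -/
noncomputable instance : NormedAddCommGroup C_c(X, ℝ) :=
  NormedAddCommGroup.induced C_c(X, ℝ) (BoundedContinuousFunction X ℝ) toBCF toBCF_injective

noncomputable instance : NormedSpace ℝ C_c(X, ℝ) :=
  NormedSpace.induced ℝ C_c(X, ℝ) (BoundedContinuousFunction X ℝ) toBCF

end Cc

end OrderRiesz

/-! Everything is reduced to the scalar Riesz theorem by means of the norm bounded positive
functionals φ. By order continuity of the norm they preserve suprema and infima of directed sets
(`PosDual.isLUB_image`, `PosDual.isGLB_image`), and by the third hypothesis on `E` they determine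
the order, so inequalities between finite elements may be checked after applying every φ.

The measure μ is built in `E` itself: an open set gets the supremum of its test values, any other
Borel set the infimum over its open supersets. Both families are directed, so monotone completeness
supplies these bounds, with ∞ allowed. If m is the Riesz measure of φ ∘ π, then m s = φ (μ s)
whenever μ s is finite (`scalarMeasure_of_outerValue_eq`). The integral formula, and σ-additivity
for unions of finite measure, are inherited from m. For a union of infinite measure the functionals
give no information (take φ = 0); there the second hypothesis on `E` enters, through open
approximations with summable norm errors (`isLUB_sum_outerValue`).

Conversely, a representing ν yields scalar measures φ ∘ ν on each set of finite measure. They give π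
f ≤ ν S if f ≺ S, and ν K ≤ π f if K ≺ f. Regularity then fixes ν on open sets, hence everywhere.
The norm bounds come from comparing π f with ‖f‖ • μ X. -/

namespace OrderRiesz

set_option linter.unusedSectionVars false

/-! ### Functionals, directed sets, and bounds in the extended space -/

section OrderedSpace

/-- The norm bounded positive functionals on `E`. -/
abbrev PosDual (E : Type*) [NormedAddCommGroup E] [NormedSpace ℝ E] [PartialOrder E] :=
  {φ : E →L[ℝ] ℝ // IsPositiveFunctional (φ : E →ₗ[ℝ] ℝ)}

variable {E : Type*} [NormedAddCommGroup E] [NormedSpace ℝ E] [PartialOrder E]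
  [IsOrderedAddMonoid E]

theorem PosDual.nonneg (φ : PosDual E) {x : E} (h : 0 ≤ x) : 0 ≤ φ.1 x := φ.2 x h

theorem PosDual.mono (φ : PosDual E) : Monotone φ.1 := fun x y h => by
  have := φ.nonneg (sub_nonneg.2 h)
  rwa [map_sub, sub_nonneg] at this

theorem MonotoneComplete.exists_isLUB (hc : MonotoneComplete E) {S : Set E} (hS : S.Nonempty)
    (hd : DirectedOn (· ≤ ·) S) (hb : BddAbove S) : ∃ s, IsLUB S s := by
  have := hS.to_subtype
  have : IsDirectedOrder S := ⟨directedOn_iff_directed.1 hd⟩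
  simpa using hc S (Subtype.val : S → E) (fun _ _ h => h) (by simpa using hb)

theorem isGLB_sub_const {S : Set E} {s : E} (h : IsGLB S s) :
    IsGLB ((fun x => x - s) '' S) 0 := by
  refine ⟨?_, fun y hy => ?_⟩
  · rintro _ ⟨x, hx, rfl⟩
    exact sub_nonneg.2 (h.1 hx)
  · have : y + s ≤ s := h.2 fun x hx => by
      have := hy ⟨x, hx, rfl⟩
      exact le_sub_iff_add_le.1 this
    simpa using this

/-- The set, indexed by itself with reversed order and translated by its infimum, is a net
decreasing to 0. -/
theorem NormOrderContinuous.exists_norm_sub_lt_of_isGLB (h1 : NormOrderContinuous E) {S : Set E}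
    (hS : S.Nonempty) (hd : DirectedOn (· ≥ ·) S) {s : E} (h : IsGLB S s) {ε : ℝ} (hε : 0 < ε) :
    ∃ x ∈ S, ‖x - s‖ < ε := by
  have := hS.to_subtype
  have : IsDirectedOrder (Sᵒᵈ : Type _) := by
    refine ⟨fun a b => ?_⟩
    obtain ⟨c, hc, h1, h2⟩ := hd a.1 (OrderDual.ofDual a).2 b.1 (OrderDual.ofDual b).2
    exact ⟨OrderDual.toDual ⟨c, hc⟩, h1, h2⟩
  have hn : Nonempty (Sᵒᵈ : Type _) := hS.to_subtype
  have ht := h1 (Sᵒᵈ : Type _) (fun x => (OrderDual.ofDual x).1 - s)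
    (fun a b hab => sub_le_sub_right (show (OrderDual.ofDual b).1 ≤ (OrderDual.ofDual a).1 from hab) s)
    (by
      convert isGLB_sub_const h using 1
      ext y
      constructor
      · rintro ⟨x, rfl⟩
        exact ⟨_, (OrderDual.ofDual x).2, rfl⟩
      · rintro ⟨x, hx, rfl⟩
        exact ⟨OrderDual.toDual ⟨x, hx⟩, rfl⟩)
  obtain ⟨x, hx⟩ := (ht.eventually (gt_mem_nhds hε)).exists
  exact ⟨_, (OrderDual.ofDual x).2, hx⟩

theorem isGLB_neg_image {S : Set E} {s : E} (h : IsLUB S s) :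
    IsGLB (Neg.neg '' S) (-s) := by
  refine ⟨?_, fun y hy => ?_⟩
  · rintro _ ⟨x, hx, rfl⟩
    exact neg_le_neg (h.1 hx)
  · exact le_neg.2 (h.2 fun x hx => le_neg.1 (hy ⟨x, hx, rfl⟩))

theorem NormOrderContinuous.exists_norm_sub_lt_of_isLUB (h1 : NormOrderContinuous E) {S : Set E}
    (hS : S.Nonempty) (hd : DirectedOn (· ≤ ·) S) {s : E} (h : IsLUB S s) {ε : ℝ} (hε : 0 < ε) :
    ∃ x ∈ S, ‖x - s‖ < ε := by
  obtain ⟨_, ⟨x, hx, rfl⟩, hlt⟩ := h1.exists_norm_sub_lt_of_isGLB (hS.image Neg.neg)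
    (by
      rintro _ ⟨a, ha, rfl⟩ _ ⟨b, hb, rfl⟩
      obtain ⟨c, hc, hac, hbc⟩ := hd a ha b hb
      exact ⟨-c, ⟨c, hc, rfl⟩, neg_le_neg hac, neg_le_neg hbc⟩) (isGLB_neg_image h) hε
  refine ⟨x, hx, ?_⟩
  rwa [neg_sub_neg, norm_sub_rev] at hlt

theorem exists_dist_lt_of_continuous (φ : E →L[ℝ] ℝ) {S : Set E} {s : E}
    (h : ∀ ε > 0, ∃ x ∈ S, ‖x - s‖ < ε) {ε : ℝ} (hε : 0 < ε) : ∃ x ∈ S, |φ x - φ s| < ε := by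
  obtain ⟨δ, hδ, hφ⟩ := Metric.continuous_iff.1 φ.continuous s ε hε
  obtain ⟨x, hx, hxs⟩ := h δ hδ
  exact ⟨x, hx, hφ x (by rwa [dist_eq_norm])⟩

/-- Norm bounded positive functionals are automatically order continuous: `S` has members close in
norm to its supremum, and φ is norm continuous and monotone. -/
theorem PosDual.isLUB_image (h1 : NormOrderContinuous E) (φ : PosDual E) {S : Set E}
    (hS : S.Nonempty) (hd : DirectedOn (· ≤ ·) S) {s : E} (h : IsLUB S s) :
    IsLUB (φ.1 '' S) (φ.1 s) := by
  refine ⟨φ.mono.mem_upperBounds_image h.1, fun y hy => le_of_forall_pos_le_add fun ε hε => ?_⟩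
  obtain ⟨x, hx, hxs⟩ := exists_dist_lt_of_continuous φ.1
    (fun ε hε => h1.exists_norm_sub_lt_of_isLUB hS hd h hε) hε
  have := hy ⟨x, hx, rfl⟩
  have := (abs_lt.1 hxs).1
  linarith

theorem PosDual.isGLB_image (h1 : NormOrderContinuous E) (φ : PosDual E) {S : Set E}
    (hS : S.Nonempty) (hd : DirectedOn (· ≥ ·) S) {s : E} (h : IsGLB S s) :
    IsGLB (φ.1 '' S) (φ.1 s) := by
  refine ⟨φ.mono.mem_lowerBounds_image h.1, fun y hy => le_of_forall_pos_le_add fun ε hε => ?_⟩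
  obtain ⟨x, hx, hxs⟩ := exists_dist_lt_of_continuous φ.1
    (fun ε hε => h1.exists_norm_sub_lt_of_isGLB hS hd h hε) hε
  have := hy ⟨x, hx, rfl⟩
  have := (abs_lt.1 hxs).2
  linarith

theorem PosDual.isLUB_range_of_monotone (h1 : NormOrderContinuous E) (φ : PosDual E) {x : ℕ → E}
    (hx : Monotone x) {s : E} (h : IsLUB (range x) s) :
    IsLUB (range fun n => φ.1 (x n)) (φ.1 s) := by
  have := φ.isLUB_image h1 (range_nonempty x) (directedOn_range.2 hx.directed_le) h
  rwa [← range_comp] at this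

/-- The order of `E` is determined by the norm bounded positive functionals. -/
def PosDualDeterminesOrder (E : Type*) [NormedAddCommGroup E] [NormedSpace ℝ E]
    [PartialOrder E] : Prop :=
  ∀ x y : E, (∀ φ : PosDual E, φ.1 x ≤ φ.1 y) → x ≤ y

/-- Testing against all norm bounded positive functionals includes the σ-order continuous ones, so
σ-order continuity need not be tracked. -/
theorem posDualDeterminesOrder
    (h3 : ∀ x : E, (∀ φ : E →L[ℝ] ℝ, IsPositiveFunctional (φ : E →ₗ[ℝ] ℝ) →
        IsSigmaOrderContinuous (φ : E →ₗ[ℝ] ℝ) → 0 ≤ φ x) → 0 ≤ x) :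
    PosDualDeterminesOrder E := fun x y h =>
  sub_nonneg.1 (h3 _ fun φ hφ _ => by
    rw [map_sub, sub_nonneg]
    exact h ⟨φ, hφ⟩)

theorem isLUB_of_isLUB_coe {α : Type*} [PartialOrder α] {S : Set α} {s : α}
    (h : IsLUB ((↑) '' S : Set (WithTop α)) (s : WithTop α)) : IsLUB S s :=
  ⟨fun _ hx => WithTop.coe_le_coe.1 (h.1 ⟨_, hx, rfl⟩), fun y hy =>
    WithTop.coe_le_coe.1 (h.2 (by
      rintro _ ⟨x, hx, rfl⟩
      exact WithTop.coe_le_coe.2 (hy hx)))⟩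

theorem isLUB_coe_of_isLUB {α : Type*} [PartialOrder α] {S : Set α} {s : α} (h : IsLUB S s) :
    IsLUB ((↑) '' S : Set (WithTop α)) (s : WithTop α) := by
  refine ⟨?_, fun y hy => ?_⟩
  · rintro _ ⟨x, hx, rfl⟩
    exact WithTop.coe_le_coe.2 (h.1 hx)
  · induction y using WithTop.recTopCoe with
    | top => exact le_top
    | coe y =>
      exact WithTop.coe_le_coe.2 (h.2 fun x hx => WithTop.coe_le_coe.1 (hy ⟨x, hx, rfl⟩))

theorem isLUB_range_coe_iff {α ι : Type*} [PartialOrder α] {x : ι → α} {s : α} :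
    IsLUB (range fun i => (x i : WithTop α)) (s : WithTop α) ↔ IsLUB (range x) s := by
  have : (range fun i => (x i : WithTop α)) = (↑) '' range x := range_comp _ _
  rw [this]
  exact ⟨isLUB_of_isLUB_coe, isLUB_coe_of_isLUB⟩

theorem isLUB_coe_top {α : Type*} [PartialOrder α] {S : Set α} (h : ¬ BddAbove S) :
    IsLUB ((↑) '' S : Set (WithTop α)) ⊤ := by
  refine ⟨fun _ _ => le_top, fun y hy => ?_⟩
  induction y using WithTop.recTopCoe with
  | top => exact le_top
  | coe y => exact (h ⟨y, fun x hx => WithTop.coe_le_coe.1 (hy ⟨x, hx, rfl⟩)⟩).elim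

theorem MonotoneComplete.exists_isLUB_coe (hc : MonotoneComplete E) {S : Set E} (hS : S.Nonempty)
    (hd : DirectedOn (· ≤ ·) S) : ∃ s, IsLUB ((↑) '' S : Set (WithTop E)) s := by
  by_cases hb : BddAbove S
  · obtain ⟨s, hs⟩ := hc.exists_isLUB hS hd hb
    exact ⟨s, isLUB_coe_of_isLUB hs⟩
  · exact ⟨⊤, isLUB_coe_top hb⟩

theorem MonotoneComplete.exists_isGLB (hc : MonotoneComplete E) {S : Set E} (hS : S.Nonempty)
    (hd : DirectedOn (· ≥ ·) S) (hb : BddBelow S) : ∃ s, IsGLB S s := by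
  obtain ⟨s, hs⟩ := hc.exists_isLUB (hS.image Neg.neg) (by
      rintro _ ⟨a, ha, rfl⟩ _ ⟨b, hb, rfl⟩
      obtain ⟨c, hc, hac, hbc⟩ := hd a ha b hb
      exact ⟨-c, ⟨c, hc, rfl⟩, neg_le_neg hac, neg_le_neg hbc⟩) (by
      obtain ⟨b, hb⟩ := hb
      refine ⟨-b, ?_⟩
      rintro _ ⟨a, ha, rfl⟩
      exact neg_le_neg (hb ha))
  refine ⟨-s, ?_⟩
  have := isGLB_neg_image hs
  rwa [image_image, show (fun x : E => - -x) = id from funext neg_neg, image_id] at this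

theorem directedOn_coe_preimage {α : Type*} [PartialOrder α] {T : Set (WithTop α)}
    (hd : DirectedOn (· ≥ ·) T) : DirectedOn (· ≥ ·) {x : α | (x : WithTop α) ∈ T} := by
  intro a ha b hb
  obtain ⟨c, hc, hac, hbc⟩ := hd _ ha _ hb
  obtain ⟨c, rfl⟩ := WithTop.ne_top_iff_exists.1 (ne_top_of_le_ne_top WithTop.coe_ne_top hac)
  exact ⟨c, hc, WithTop.coe_le_coe.1 hac, WithTop.coe_le_coe.1 hbc⟩

theorem isGLB_coe_preimage {α : Type*} [PartialOrder α] {T : Set (WithTop α)} {s : α}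
    (h : IsGLB T (s : WithTop α)) : IsGLB {x : α | (x : WithTop α) ∈ T} s := by
  refine ⟨fun x hx => WithTop.coe_le_coe.1 (h.1 hx), fun y hy => WithTop.coe_le_coe.1 (h.2 ?_)⟩
  intro t ht
  induction t using WithTop.recTopCoe with
  | top => exact le_top
  | coe t => exact WithTop.coe_le_coe.2 (hy ht)

/-- A finite member of `T` forces every lower bound to be finite, so infinite members are irrelevant
to the infimum. -/
theorem isGLB_coe_of_preimage {α : Type*} [PartialOrder α] {T : Set (WithTop α)} {s : α}
    (hT : {x : α | (x : WithTop α) ∈ T}.Nonempty)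
    (h : IsGLB {x : α | (x : WithTop α) ∈ T} s) : IsGLB T (s : WithTop α) := by
  refine ⟨fun t ht => ?_, fun y hy => ?_⟩
  · induction t using WithTop.recTopCoe with
    | top => exact le_top
    | coe t => exact WithTop.coe_le_coe.2 (h.1 ht)
  · obtain ⟨x, hx⟩ := hT
    obtain ⟨y, rfl⟩ := WithTop.ne_top_iff_exists.1 (ne_top_of_le_ne_top WithTop.coe_ne_top (hy hx))
    exact WithTop.coe_le_coe.2 (h.2 fun z hz => WithTop.coe_le_coe.1 (hy hz))

theorem MonotoneComplete.exists_isGLB_withTop (hc : MonotoneComplete E) {T : Set (WithTop E)}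
    (hd : DirectedOn (· ≥ ·) T) (h0 : ∀ t ∈ T, 0 ≤ t) : ∃ s, IsGLB T s := by
  by_cases hT : {x : E | (x : WithTop E) ∈ T}.Nonempty
  · obtain ⟨s, hs⟩ := hc.exists_isGLB hT (directedOn_coe_preimage hd)
      ⟨0, fun x hx => WithTop.coe_le_coe.1 (h0 _ hx)⟩
    exact ⟨s, isGLB_coe_of_preimage hT hs⟩
  · refine ⟨⊤, fun t ht => ?_, fun _ _ => le_top⟩
    induction t using WithTop.recTopCoe with
    | top => exact le_rfl
    | coe t => exact (hT ⟨t, ht⟩).elim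

theorem exists_coe_mem_of_isGLB {α : Type*} [PartialOrder α] {T : Set (WithTop α)} {s : α}
    (h : IsGLB T (s : WithTop α)) : {x : α | (x : WithTop α) ∈ T}.Nonempty := by
  by_contra hne
  have : (⊤ : WithTop α) ≤ s := h.2 fun t ht => by
    induction t using WithTop.recTopCoe with
    | top => exact le_rfl
    | coe t => exact (hne ⟨t, ht⟩).elim
  exact WithTop.coe_ne_top (top_le_iff.1 this)

end OrderedSpace

/-! ### Scalar measures φ ∘ ν and the order integral -/

section Scalarization

variable {X E : Type*} [MeasurableSpace X] [NormedAddCommGroup E] [NormedSpace ℝ E]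
  [PartialOrder E] [IsOrderedAddMonoid E]

theorem PosMeasure.mono (ν : PosMeasure X E) {A B : Set X} (hA : MeasurableSet A)
    (hB : MeasurableSet B) (h : A ⊆ B) : ν A ≤ ν B := by
  let s : ℕ → Set X := fun n => if n = 0 then A else if n = 1 then B \ A else ∅
  have hs : ∀ n, MeasurableSet (s n) := fun n => by
    dsimp only [s]
    split_ifs
    exacts [hA, hB.diff hA, MeasurableSet.empty]
  have hd : Pairwise (fun i j => Disjoint (s i) (s j)) := by
    intro i j hij
    dsimp only [s]
    split_ifs <;> first | omega | simp [disjoint_sdiff_left, disjoint_sdiff_right]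
  have hU : ⋃ n, s n = B := by
    ext x
    simp only [mem_iUnion]
    constructor
    · rintro ⟨n, hn⟩
      dsimp only [s] at hn
      split_ifs at hn
      exacts [h hn, hn.1, hn.elim]
    · intro hx
      by_cases hxA : x ∈ A
      · exact ⟨0, by simpa [s] using hxA⟩
      · exact ⟨1, by simpa [s] using ⟨hx, hxA⟩⟩
  -- The partial sum with one term is ν A.
  have := (ν.sigma_additive' s hs hd).1 ⟨1, rfl⟩
  rw [hU] at this
  simpa [s] using this

/-- The scalar measure `m` agrees with `φ ∘ ν` on the measurable subsets of `C` with finite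
measure. -/
def ScalarizesOn (ν : PosMeasure X E) (C : Set X) (φ : PosDual E) (m : Measure X) : Prop :=
  ∀ A, MeasurableSet A → A ⊆ C → ∀ a : E, ν A = a → m A = ENNReal.ofReal (φ.1 a)

/-- Cutting down to `C` makes all values finite, so φ can be applied; σ-additivity survives because
φ preserves suprema of increasing sequences. -/
theorem exists_scalarizesOn (h1 : NormOrderContinuous E) (ν : PosMeasure X E) {C : Set X}
    (hC : MeasurableSet C) (hνC : ν C ≠ ⊤) (φ : PosDual E) :
    ∃ m : Measure X, ScalarizesOn ν C φ m := by
  let a : Set X → E := fun A => (ν (A ∩ C)).untopD 0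
  have ha : ∀ A, MeasurableSet A → ν (A ∩ C) = a A := fun A hA => by
    have : ν (A ∩ C) ≠ ⊤ :=
      ne_top_of_le_ne_top hνC (ν.mono (hA.inter hC) hC inter_subset_right)
    obtain ⟨b, hb⟩ := WithTop.ne_top_iff_exists.1 this
    simp only [a, ← hb, WithTop.untopD_coe]
  have ha0 : ∀ A, MeasurableSet A → 0 ≤ a A := fun A hA =>
    WithTop.coe_le_coe.1 ((ν.nonneg' (A ∩ C)).trans_eq (ha A hA))
  refine ⟨Measure.ofMeasurable (fun A _ => ENNReal.ofReal (φ.1 (a A))) ?_ ?_, ?_⟩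
  · simp [a, ν.empty']
  · intro s hs hd
    have hLUB := ν.sigma_additive' (fun n => s n ∩ C) (fun n => (hs n).inter hC)
      (fun i j hij => (hd hij).mono inter_subset_left inter_subset_left)
    rw [← iUnion_inter, ha _ (MeasurableSet.iUnion hs)] at hLUB
    simp only [ha _ (hs _), ← WithTop.coe_sum] at hLUB
    rw [isLUB_range_coe_iff] at hLUB
    have hmono : Monotone fun N => ∑ n ∈ Finset.range N, a (s n) := monotone_nat_of_le_succ
      fun N => by
        rw [Finset.sum_range_succ]
        exact le_add_of_nonneg_right (ha0 _ (hs N))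
    have ht := tendsto_atTop_isLUB (φ.mono.comp hmono) (φ.isLUB_range_of_monotone h1 hmono hLUB)
    have ht' : Tendsto (fun N => ∑ n ∈ Finset.range N, ENNReal.ofReal (φ.1 (a (s n)))) atTop
        (𝓝 (ENNReal.ofReal (φ.1 (a (⋃ i, s i))))) := by
      refine (ENNReal.tendsto_ofReal ht).congr fun N => ?_
      rw [Function.comp, map_sum,
        ENNReal.ofReal_sum_of_nonneg fun n _ => φ.nonneg (ha0 _ (hs n))]
    exact tendsto_nhds_unique ht' (ENNReal.tendsto_nat_tsum _)
  · intro A hA hAC b hb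
    rw [Measure.ofMeasurable_apply A hA]
    simp [a, inter_eq_left.2 hAC, hb]

theorem preimage_singleton_subset {C : Set X} {ψ : SimpleFunc X ℝ≥0} (hψ : ∀ x ∉ C, ψ x = 0)
    {r : ℝ≥0} (hr : r ≠ 0) : ψ ⁻¹' {r} ⊆ C := fun x hx => by
  by_contra hxC
  exact hr ((mem_singleton_iff.1 hx).symm.trans (hψ x hxC))

theorem elementaryIntegral_eq_coe [IsOrderedModule ℝ E] (ν : PosMeasure X E) {C : Set X}
    (hC : MeasurableSet C) (hνC : ν C ≠ ⊤) {ψ : SimpleFunc X ℝ≥0} (hψ : ∀ x ∉ C, ψ x = 0) :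
    ∃ a : E, elementaryIntegral ν ψ = a ∧ 0 ≤ a ∧ ∀ (φ : PosDual E) (m : Measure X),
      ScalarizesOn ν C φ m → ∫⁻ x, ψ x ∂m = ENNReal.ofReal (φ.1 a) := by
  -- Only the level set of 0 can have infinite measure, and there the coefficient 0 makes the
  -- default value harmless.
  let b : ℝ≥0 → E := fun r => (ν (ψ ⁻¹' {r})).untopD 0
  have hb : ∀ r, r ≠ 0 → ν (ψ ⁻¹' {r}) = b r := fun r hr => by
    obtain ⟨c, hc⟩ := WithTop.ne_top_iff_exists.1 (ne_top_of_le_ne_top hνC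
      (ν.mono (ψ.measurableSet_preimage {r}) hC (preimage_singleton_subset hψ hr)))
    simp only [b, ← hc, WithTop.untopD_coe]
  have hb0 : ∀ r, r ≠ 0 → 0 ≤ b r := fun r hr =>
    WithTop.coe_le_coe.1 ((ν.nonneg' _).trans_eq (hb r hr))
  have hrb : ∀ r : ℝ≥0, 0 ≤ (r : ℝ) • b r := fun r => by
    rcases eq_or_ne r 0 with rfl | hr
    · simp
    · exact smul_nonneg r.2 (hb0 r hr)
  refine ⟨∑ r ∈ ψ.range, (r : ℝ) • b r, ?_, Finset.sum_nonneg fun r _ => hrb r, fun φ m hm => ?_⟩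
  · rw [elementaryIntegral, WithTop.coe_sum]
    refine Finset.sum_congr rfl fun r _ => ?_
    rcases eq_or_ne r 0 with rfl | hr
    · cases h : ν (ψ ⁻¹' {0}) <;> simp [extSMul]
    · rw [hb r hr]
      rfl
  · have hmap : ∫⁻ x, ψ x ∂m = (ψ.map ((↑) : ℝ≥0 → ℝ≥0∞)).lintegral m := by
      rw [← SimpleFunc.lintegral_eq_lintegral]
      rfl
    rw [hmap, SimpleFunc.map_lintegral, map_sum,
      ENNReal.ofReal_sum_of_nonneg fun r _ => φ.nonneg (hrb r)]
    refine Finset.sum_congr rfl fun r _ => ?_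
    rcases eq_or_ne r 0 with rfl | hr
    · simp
    · rw [hm _ (ψ.measurableSet_preimage {r}) (preimage_singleton_subset hψ hr) _ (hb r hr),
        map_smul, smul_eq_mul, ENNReal.ofReal_mul (NNReal.coe_nonneg r), ENNReal.ofReal_coe_nnreal]

/-- Monotone convergence for simple functions that increase to `f`. -/
theorem lintegral_eq_iSup_of_simpleFunc {f : X → ℝ≥0∞} {ψ : ℕ → SimpleFunc X ℝ≥0}
    (hψ : Monotone ψ) (hf : ∀ x, ⨆ n, (ψ n x : ℝ≥0∞) = f x) (m : Measure X) :
    ∫⁻ x, f x ∂m = ⨆ n, ∫⁻ x, ψ n x ∂m := by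
  simp_rw [← hf]
  exact lintegral_iSup (fun n => (ψ n).measurable.coe_nnreal_ennreal)
    fun i j hij x => ENNReal.coe_le_coe.2 (hψ hij x)

theorem eq_zero_of_iSup_eq_zero {f : X → ℝ≥0∞} {ψ : ℕ → SimpleFunc X ℝ≥0}
    (hf : ∀ x, ⨆ n, (ψ n x : ℝ≥0∞) = f x) {C : Set X} (hfC : ∀ x ∉ C, f x = 0) (n : ℕ) :
    ∀ x ∉ C, ψ n x = 0 := fun x hx => by
  have : (ψ n x : ℝ≥0∞) ≤ f x := (hf x) ▸ le_iSup (fun n => (ψ n x : ℝ≥0∞)) n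
  rw [hfC x hx] at this
  simpa using this

/-- Monotone convergence on the scalar side meets order continuity of φ on the vector side: both
sides are limits of the same elementary integrals. -/
theorem HasPosOrderIntegral.lintegral_eq [IsOrderedModule ℝ E] (h1 : NormOrderContinuous E)
    (hle : PosDualDeterminesOrder E) {ν : PosMeasure X E} {C : Set X}
    (hC : MeasurableSet C) (hνC : ν C ≠ ⊤) {f : X → ℝ≥0∞} (hfC : ∀ x ∉ C, f x = 0) {y : E}
    (h : HasPosOrderIntegral ν f (y : WithTop E)) :
    0 ≤ y ∧ ∀ (φ : PosDual E) (m : Measure X), ScalarizesOn ν C φ m →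
      ∫⁻ x, f x ∂m = ENNReal.ofReal (φ.1 y) := by
  obtain ⟨ψ, hψ, hf, hy⟩ := h
  choose a ha ha0 hφ using fun n =>
    elementaryIntegral_eq_coe ν hC hνC (eq_zero_of_iSup_eq_zero hf hfC n)
  simp only [ha] at hy
  rw [isLUB_range_coe_iff] at hy
  have hmono : Monotone a := fun i j hij => hle _ _ fun φ => by
    obtain ⟨m, hm⟩ := exists_scalarizesOn h1 ν hC hνC φ
    rw [← ENNReal.ofReal_le_ofReal_iff (φ.nonneg (ha0 j)), ← hφ i φ m hm, ← hφ j φ m hm]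
    exact lintegral_mono fun x => ENNReal.coe_le_coe.2 (hψ hij x)
  refine ⟨(ha0 0).trans (hy.1 ⟨0, rfl⟩), fun φ m hm => ?_⟩
  rw [lintegral_eq_iSup_of_simpleFunc hψ hf m]
  simp only [hφ _ φ m hm]
  have ht := tendsto_atTop_isLUB (φ.mono.comp hmono) (φ.isLUB_range_of_monotone h1 hmono hy)
  exact tendsto_nhds_unique (tendsto_atTop_iSup fun i j hij =>
    ENNReal.ofReal_le_ofReal (φ.mono (hmono hij))) (ENNReal.tendsto_ofReal ht)

/-- Both halves of the supremum property are inequalities in `E`, so they can be tested by one φ at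
a time, each with its own scalar measure. -/
theorem hasPosOrderIntegral_of_lintegral_eq [IsOrderedModule ℝ E]
    (hle : PosDualDeterminesOrder E) {ν : PosMeasure X E} {C : Set X}
    (hC : MeasurableSet C) (hνC : ν C ≠ ⊤) {f : X → ℝ≥0∞} (hfm : Measurable f)
    (hfC : ∀ x ∉ C, f x = 0) {y : E} (hy : 0 ≤ y)
    (h : ∀ φ : PosDual E, ∃ m : Measure X, ScalarizesOn ν C φ m ∧
      ∫⁻ x, f x ∂m = ENNReal.ofReal (φ.1 y)) :
    HasPosOrderIntegral ν f (y : WithTop E) := by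
  let ψ : ℕ → SimpleFunc X ℝ≥0 := fun n => (SimpleFunc.eapprox f n).map ENNReal.toNNReal
  have hψx : ∀ n x, (ψ n x : ℝ≥0∞) = SimpleFunc.eapprox f n x := fun n x =>
    ENNReal.coe_toNNReal (SimpleFunc.eapprox_lt_top f n x).ne
  have hψ : Monotone ψ := fun i j hij x => by
    rw [← ENNReal.coe_le_coe, hψx, hψx]
    exact SimpleFunc.monotone_eapprox f hij x
  have hf : ∀ x, ⨆ n, (ψ n x : ℝ≥0∞) = f x := fun x => by
    simp only [hψx]
    exact SimpleFunc.iSup_eapprox_apply hfm x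
  refine ⟨ψ, hψ, hf, ?_⟩
  choose a ha ha0 hφ using fun n =>
    elementaryIntegral_eq_coe ν hC hνC (eq_zero_of_iSup_eq_zero hf hfC n)
  simp only [ha]
  rw [isLUB_range_coe_iff]
  constructor
  · rintro _ ⟨n, rfl⟩
    refine hle _ _ fun φ => ?_
    obtain ⟨m, hm, hmf⟩ := h φ
    rw [← ENNReal.ofReal_le_ofReal_iff (φ.nonneg hy), ← hφ n φ m hm, ← hmf,
      lintegral_eq_iSup_of_simpleFunc hψ hf m]
    exact le_iSup (fun n => ∫⁻ x, ψ n x ∂m) n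
  · intro z hz
    have hz0 : 0 ≤ z := (ha0 0).trans (hz ⟨0, rfl⟩)
    refine hle _ _ fun φ => ?_
    obtain ⟨m, hm, hmf⟩ := h φ
    rw [← ENNReal.ofReal_le_ofReal_iff (φ.nonneg hz0), ← hmf,
      lintegral_eq_iSup_of_simpleFunc hψ hf m]
    refine iSup_le fun n => ?_
    rw [hφ n φ m hm]
    exact ENNReal.ofReal_le_ofReal (φ.mono (hz ⟨n, rfl⟩))

end Scalarization

/-! ### Test functions and Urysohn's lemma -/

section TestFunctions

variable {X : Type*} [TopologicalSpace X]

theorem PrecSet.nonneg {f : C_c(X, ℝ)} {S : Set X} (h : PrecSet f S) : 0 ≤ f := fun x => (h.1 x).1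

theorem SetPrec.nonneg {f : C_c(X, ℝ)} {S : Set X} (h : SetPrec S f) : 0 ≤ f := fun x => (h.1 x).1

theorem PrecSet.mono {f : C_c(X, ℝ)} {S T : Set X} (h : PrecSet f S) (hST : S ⊆ T) : PrecSet f T :=
  ⟨h.1, h.2.trans hST⟩

theorem precSet_zero (S : Set X) : PrecSet (0 : C_c(X, ℝ)) S :=
  ⟨fun x => by simp, by simp [tsupport]⟩

theorem PrecSet.sup {f g : C_c(X, ℝ)} {S : Set X} (hf : PrecSet f S) (hg : PrecSet g S) :
    PrecSet (f ⊔ g) S := by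
  refine ⟨fun x => ?_, ?_⟩
  · rw [CompactlySupportedContinuousMap.sup_apply]
    exact ⟨le_sup_of_le_left (hf.1 x).1, sup_le (hf.1 x).2 (hg.1 x).2⟩
  · refine Subset.trans (closure_minimal ?_ ((isClosed_tsupport f).union (isClosed_tsupport g)))
      (union_subset hf.2 hg.2)
    intro x hx
    by_contra h
    rw [mem_union, not_or] at h
    refine hx ?_
    rw [CompactlySupportedContinuousMap.sup_apply, image_eq_zero_of_notMem_tsupport h.1,
      image_eq_zero_of_notMem_tsupport h.2, sup_idem]

theorem exists_setPrec_precSet [T2Space X] [LocallyCompactSpace X] {K V : Set X}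
    (hK : IsCompact K) (hV : IsOpen V) (h : K ⊆ V) : ∃ f : C_c(X, ℝ), SetPrec K f ∧ PrecSet f V := by
  obtain ⟨f, hf1, hfc, hfV, hf⟩ := exists_continuousMap_one_of_isCompact_subset_isOpen hK hV h
  exact ⟨⟨f, hfc⟩, ⟨hf, hf1⟩, hf, hfV⟩

theorem sup_zero_sub_neg_sup_zero (f : C_c(X, ℝ)) : f ⊔ 0 - (-f) ⊔ 0 = f := by
  ext x
  simp only [CompactlySupportedContinuousMap.sub_apply, CompactlySupportedContinuousMap.sup_apply,
    CompactlySupportedContinuousMap.neg_apply, CompactlySupportedContinuousMap.zero_apply]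
  rcases le_total (f x) 0 with h | h
  · rw [sup_eq_right.2 h, sup_eq_left.2 (neg_nonneg.2 h), zero_sub, neg_neg]
  · rw [sup_eq_left.2 h, sup_eq_right.2 (neg_nonpos.2 h), sub_zero]

variable [MeasurableSpace X] [BorelSpace X]

theorem PrecSet.lintegral_le {f : C_c(X, ℝ)} {S : Set X} (h : PrecSet f S) (m : Measure X) :
    ∫⁻ x, ENNReal.ofReal (f x) ∂m ≤ m S := by
  refine le_trans ?_ (measure_mono h.2)
  rw [← lintegral_indicator_one (isClosed_tsupport f).measurableSet]
  refine lintegral_mono fun x => ?_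
  by_cases hx : x ∈ tsupport f
  · simpa [hx] using (h.1 x).2
  · simp [image_eq_zero_of_notMem_tsupport hx]

theorem SetPrec.le_lintegral [T2Space X] {f : C_c(X, ℝ)} {K : Set X} (h : SetPrec K f)
    (hK : IsCompact K) (m : Measure X) : m K ≤ ∫⁻ x, ENNReal.ofReal (f x) ∂m := by
  rw [← lintegral_indicator_one hK.measurableSet]
  refine lintegral_mono fun x => ?_
  by_cases hx : x ∈ K
  · simp [hx, h.2 x hx]
  · simp [hx]

end TestFunctions

/-! ### Construction of the vector measure -/

section Construction

variable {X E : Type*} [NormedAddCommGroup E] [NormedSpace ℝ E]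
  [PartialOrder E] [IsOrderedAddMonoid E] [TopologicalSpace X] (π : C_c(X, ℝ) →ₗ[ℝ] E)

/-- The values of `π` at the functions `f` with `f ≺ V`. -/
def testValues (V : Set X) : Set E := {y | ∃ f : C_c(X, ℝ), PrecSet f V ∧ y = π f}

/-- The supremum of the values of `π` at the functions `f` with `f ≺ V` in the extended space. -/
noncomputable def openValue (V : Set X) : WithTop E :=
  Classical.epsilon fun s => IsLUB ((↑) '' testValues π V) s

/-- The infimum of the values at the open supersets of `s` in the extended space. -/
noncomputable def outerValue (s : Set X) : WithTop E :=
  Classical.epsilon fun t =>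
    IsGLB {y : WithTop E | ∃ V : Set X, IsOpen V ∧ s ⊆ V ∧ y = openValue π V} t

theorem coe_image_testValues (V : Set X) : ((↑) '' testValues π V : Set (WithTop E)) =
    {y : WithTop E | ∃ f : C_c(X, ℝ), PrecSet f V ∧ y = (π f : E)} := by
  ext y
  constructor
  · rintro ⟨_, ⟨f, hf, rfl⟩, rfl⟩
    exact ⟨f, hf, rfl⟩
  · rintro ⟨f, hf, rfl⟩
    exact ⟨_, ⟨f, hf, rfl⟩, rfl⟩

theorem testValues_nonempty (V : Set X) : (testValues π V).Nonempty := ⟨_, 0, precSet_zero V, rfl⟩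

variable {π}

theorem monotone_of_nonneg (hπ : ∀ f : C_c(X, ℝ), 0 ≤ f → 0 ≤ π f) : Monotone π := fun f g h => by
  have := hπ (g - f) fun x => by simpa using h x
  rwa [map_sub, sub_nonneg] at this

theorem directedOn_testValues (hπ : ∀ f : C_c(X, ℝ), 0 ≤ f → 0 ≤ π f) (V : Set X) :
    DirectedOn (· ≤ ·) (testValues π V) := by
  rintro _ ⟨f, hf, rfl⟩ _ ⟨g, hg, rfl⟩
  exact ⟨_, ⟨f ⊔ g, hf.sup hg, rfl⟩, monotone_of_nonneg hπ le_sup_left,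
    monotone_of_nonneg hπ le_sup_right⟩

theorem isLUB_openValue (hc : MonotoneComplete E) (hπ : ∀ f : C_c(X, ℝ), 0 ≤ f → 0 ≤ π f)
    (V : Set X) : IsLUB ((↑) '' testValues π V) (openValue π V) :=
  Classical.epsilon_spec (hc.exists_isLUB_coe (testValues_nonempty π V) (directedOn_testValues hπ V))

section

variable (hc : MonotoneComplete E) (hπ : ∀ f : C_c(X, ℝ), 0 ≤ f → 0 ≤ π f)

include hc hπ

theorem openValue_mono {U V : Set X} (h : U ⊆ V) : openValue π U ≤ openValue π V :=
  (isLUB_openValue hc hπ U).mono (isLUB_openValue hc hπ V)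
    (image_mono fun _ ⟨f, hf, hy⟩ => ⟨f, hf.mono h, hy⟩)

theorem openValue_nonneg (V : Set X) : 0 ≤ openValue π V :=
  (isLUB_openValue hc hπ V).1 ⟨0, ⟨0, precSet_zero V, (map_zero π).symm⟩, rfl⟩

theorem directedOn_openValue (s : Set X) : DirectedOn (· ≥ ·)
    {y : WithTop E | ∃ V : Set X, IsOpen V ∧ s ⊆ V ∧ y = openValue π V} := by
  rintro _ ⟨U, hU, hsU, rfl⟩ _ ⟨V, hV, hsV, rfl⟩
  exact ⟨_, ⟨U ∩ V, hU.inter hV, subset_inter hsU hsV, rfl⟩,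
    openValue_mono hc hπ inter_subset_left, openValue_mono hc hπ inter_subset_right⟩

theorem isGLB_outerValue (s : Set X) :
    IsGLB {y : WithTop E | ∃ V : Set X, IsOpen V ∧ s ⊆ V ∧ y = openValue π V} (outerValue π s) :=
  Classical.epsilon_spec (hc.exists_isGLB_withTop (directedOn_openValue hc hπ s) (by
    rintro _ ⟨V, -, -, rfl⟩
    exact openValue_nonneg hc hπ V))

theorem outerValue_nonneg (s : Set X) : 0 ≤ outerValue π s :=
  (isGLB_outerValue hc hπ s).2 (by
    rintro _ ⟨V, -, -, rfl⟩
    exact openValue_nonneg hc hπ V)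

theorem outerValue_mono {s t : Set X} (h : s ⊆ t) : outerValue π s ≤ outerValue π t :=
  (isGLB_outerValue hc hπ t).mono (isGLB_outerValue hc hπ s)
    fun _ ⟨V, hV, htV, hy⟩ => ⟨V, hV, h.trans htV, hy⟩

theorem outerValue_le_openValue {s V : Set X} (hV : IsOpen V) (h : s ⊆ V) :
    outerValue π s ≤ openValue π V :=
  (isGLB_outerValue hc hπ s).1 ⟨V, hV, h, rfl⟩

theorem outerValue_of_isOpen {V : Set X} (hV : IsOpen V) : outerValue π V = openValue π V :=
  le_antisymm (outerValue_le_openValue hc hπ hV Subset.rfl)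
    ((isGLB_outerValue hc hπ V).2 (by
      rintro _ ⟨U, -, hVU, rfl⟩
      exact openValue_mono hc hπ hVU))

theorem outerValue_empty : outerValue π ∅ = 0 := by
  rw [outerValue_of_isOpen hc hπ isOpen_empty]
  refine le_antisymm ((isLUB_openValue hc hπ ∅).2 ?_) (openValue_nonneg hc hπ ∅)
  rintro _ ⟨_, ⟨f, hf, rfl⟩, rfl⟩
  have : f = 0 := by
    ext x
    exact image_eq_zero_of_notMem_tsupport fun hx => hf.2 hx
  simp [this]

theorem outerValue_ne_top_of_isCompact [T2Space X] [LocallyCompactSpace X] {K : Set X}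
    (hK : IsCompact K) : outerValue π K ≠ ⊤ := by
  obtain ⟨C, hC, hKC⟩ := exists_compact_superset hK
  obtain ⟨g, hg, -⟩ := exists_setPrec_precSet hC isOpen_univ (subset_univ C)
  -- Since g = 1 on `C`, it dominates every f ≺ interior C, so π g bounds the value of this open
  -- neighbourhood of `K`.
  refine ne_top_of_le_ne_top (WithTop.coe_ne_top (a := π g))
    ((outerValue_le_openValue hc hπ isOpen_interior hKC).trans
      ((isLUB_openValue hc hπ _).2 ?_))
  rintro _ ⟨_, ⟨f, hf, rfl⟩, rfl⟩
  refine WithTop.coe_le_coe.2 (monotone_of_nonneg hπ fun x => ?_)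
  by_cases hx : x ∈ C
  · exact (hf.1 x).2.trans_eq (hg.2 x hx).symm
  · exact (image_eq_zero_of_notMem_tsupport fun h => hx (interior_subset (hf.2 h))).trans_le
      (hg.1 x).1

theorem exists_openValue_norm_sub_lt (h1 : NormOrderContinuous E) {s : Set X} {a : E}
    (h : outerValue π s = a) {ε : ℝ} (hε : 0 < ε) :
    ∃ V : Set X, IsOpen V ∧ s ⊆ V ∧ ∃ b : E, openValue π V = b ∧ ‖b - a‖ < ε := by
  have hG := isGLB_outerValue hc hπ s
  rw [h] at hG
  obtain ⟨b, ⟨V, hV, hsV, hb⟩, hba⟩ := h1.exists_norm_sub_lt_of_isGLB (exists_coe_mem_of_isGLB hG)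
    (directedOn_coe_preimage (directedOn_openValue hc hπ s)) (isGLB_coe_preimage hG) hε
  exact ⟨V, hV, hsV, b, hb.symm, hba⟩

end

/-! ### Comparison with the scalar Riesz measures, and σ-additivity -/

section Scalar

variable [T2Space X] [LocallyCompactSpace X] [MeasurableSpace X] [BorelSpace X]

theorem exists_regular_lintegral_eq (hπ : ∀ f : C_c(X, ℝ), 0 ≤ f → 0 ≤ π f) (φ : PosDual E) :
    ∃ m : Measure X, m.Regular ∧ ∀ f : C_c(X, ℝ), 0 ≤ f →
      ∫⁻ x, ENNReal.ofReal (f x) ∂m = ENNReal.ofReal (φ.1 (π f)) := by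
  let Λ : C_c(X, ℝ) →ₚ[ℝ] ℝ := PositiveLinearMap.mk₀ ((φ.1 : E →ₗ[ℝ] ℝ) ∘ₗ π)
    fun f hf => φ.nonneg (hπ f hf)
  refine ⟨RealRMK.rieszMeasure Λ, inferInstance, fun f hf => ?_⟩
  have h := RealRMK.integral_rieszMeasure Λ f
  have hi : Integrable (fun x => f x) (RealRMK.rieszMeasure Λ) :=
    f.continuous.integrable_of_hasCompactSupport f.hasCompactSupport
  rw [← ofReal_integral_eq_lintegral_ofReal hi (ae_of_all _ hf), h]
  rfl

/-- The Riesz measure of the functional `φ ∘ π`. -/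
noncomputable def scalarMeasure (hπ : ∀ f : C_c(X, ℝ), 0 ≤ f → 0 ≤ π f) (φ : PosDual E) :
    Measure X :=
  (exists_regular_lintegral_eq hπ φ).choose

variable (hπ : ∀ f : C_c(X, ℝ), 0 ≤ f → 0 ≤ π f) (φ : PosDual E)

instance : (scalarMeasure hπ φ).Regular := (exists_regular_lintegral_eq hπ φ).choose_spec.1

theorem lintegral_scalarMeasure {f : C_c(X, ℝ)} (hf : 0 ≤ f) :
    ∫⁻ x, ENNReal.ofReal (f x) ∂(scalarMeasure hπ φ) = ENNReal.ofReal (φ.1 (π f)) :=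
  (exists_regular_lintegral_eq hπ φ).choose_spec.2 f hf

variable (hc : MonotoneComplete E)

include hc

/-- One inequality is inner regularity of the scalar measure with Urysohn functions; the other is
order continuity of φ. -/
theorem scalarMeasure_of_openValue_eq (h1 : NormOrderContinuous E) {V : Set X} (hV : IsOpen V)
    {a : E} (h : openValue π V = a) : scalarMeasure hπ φ V = ENNReal.ofReal (φ.1 a) := by
  have hL := isLUB_openValue hc hπ V
  rw [h] at hL
  have hL' := isLUB_of_isLUB_coe hL
  apply le_antisymm
  · rw [hV.measure_eq_iSup_isCompact]
    refine iSup_le fun K => iSup_le fun hKV => iSup_le fun hK => ?_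
    obtain ⟨f, hKf, hfV⟩ := exists_setPrec_precSet hK hV hKV
    refine (hKf.le_lintegral hK _).trans ?_
    rw [lintegral_scalarMeasure hπ φ hfV.nonneg]
    exact ENNReal.ofReal_le_ofReal (φ.mono (hL'.1 ⟨f, hfV, rfl⟩))
  · by_cases ht : scalarMeasure hπ φ V = ⊤
    · exact ht ▸ le_top
    · rw [ENNReal.ofReal_le_iff_le_toReal ht]
      refine (φ.isLUB_image h1 (testValues_nonempty π V) (directedOn_testValues hπ V) hL').2 ?_
      rintro _ ⟨_, ⟨f, hf, rfl⟩, rfl⟩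
      rw [← ENNReal.ofReal_le_iff_le_toReal ht, ← lintegral_scalarMeasure hπ φ hf.nonneg]
      exact hf.lintegral_le _

theorem scalarMeasure_of_outerValue_eq (h1 : NormOrderContinuous E) {s : Set X}
    {a : E} (h : outerValue π s = a) : scalarMeasure hπ φ s = ENNReal.ofReal (φ.1 a) := by
  have hG := isGLB_outerValue hc hπ s
  rw [h] at hG
  have hG' := isGLB_coe_preimage hG
  have hne := exists_coe_mem_of_isGLB hG
  apply le_antisymm
  · have hφ := φ.isGLB_image h1 hne (directedOn_coe_preimage (directedOn_openValue hc hπ s)) hG'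
    have ht : scalarMeasure hπ φ s ≠ ⊤ := by
      obtain ⟨b, V, hV, hsV, hb⟩ := hne
      refine ne_top_of_le_ne_top ?_ (measure_mono hsV)
      rw [scalarMeasure_of_openValue_eq hπ φ hc h1 hV hb.symm]
      exact ENNReal.ofReal_ne_top
    rw [← ENNReal.ofReal_toReal ht]
    refine ENNReal.ofReal_le_ofReal (hφ.2 ?_)
    rintro _ ⟨b, ⟨V, hV, hsV, hb⟩, rfl⟩
    have hb0 : 0 ≤ b := WithTop.coe_le_coe.1 ((openValue_nonneg hc hπ V).trans_eq hb.symm)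
    refine ENNReal.toReal_le_of_le_ofReal (φ.nonneg hb0) ?_
    rw [← scalarMeasure_of_openValue_eq hπ φ hc h1 hV hb.symm]
    exact measure_mono hsV
  · rw [s.measure_eq_iInf_isOpen]
    refine le_iInf fun U => le_iInf fun hsU => le_iInf fun hU => ?_
    -- The value of `U` may be infinite, so `U` is first intersected with an open superset of finite
    -- value.
    obtain ⟨b, V, hV, hsV, hb⟩ := hne
    obtain ⟨c, hc'⟩ := WithTop.ne_top_iff_exists.1 (ne_top_of_le_ne_top WithTop.coe_ne_top
      ((openValue_mono hc hπ (inter_subset_right : U ∩ V ⊆ V)).trans_eq hb.symm))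
    refine le_trans ?_ (measure_mono (inter_subset_left : U ∩ V ⊆ U))
    rw [scalarMeasure_of_openValue_eq hπ φ hc h1 (hU.inter hV) hc'.symm]
    exact ENNReal.ofReal_le_ofReal (φ.mono (hG'.1 ⟨U ∩ V, hU.inter hV, subset_inter hsU hsV, hc'⟩))

variable (h1 : NormOrderContinuous E) (hle : PosDualDeterminesOrder E)

include hπ hle h1

/-- The compact support of a test function lies in finitely many `V n`, so finite subadditivity of
the scalar measures suffices. Finiteness of the union's value is a conclusion here. -/
theorem openValue_iUnion_le {V : ℕ → Set X} (hV : ∀ n, IsOpen (V n)) {b : ℕ → E}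
    (hb : ∀ n, openValue π (V n) = b n) {c : E}
    (hcb : ∀ N, ∑ n ∈ Finset.range N, b n ≤ c) : openValue π (⋃ n, V n) ≤ c := by
  have hb0 : ∀ n, 0 ≤ b n := fun n =>
    WithTop.coe_le_coe.1 ((openValue_nonneg hc hπ (V n)).trans_eq (hb n))
  refine (isLUB_openValue hc hπ _).2 ?_
  rintro _ ⟨_, ⟨f, hf, rfl⟩, rfl⟩
  refine WithTop.coe_le_coe.2 (hle _ _ fun φ => ?_)
  obtain ⟨t, ht⟩ := f.hasCompactSupport.isCompact.elim_finite_subcover V hV hf.2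
  obtain ⟨N, hN⟩ := t.exists_nat_subset_range
  refine (φ.mono (hcb N)).trans' ?_
  rw [← ENNReal.ofReal_le_ofReal_iff (φ.nonneg (Finset.sum_nonneg fun n _ => hb0 n)),
    ← lintegral_scalarMeasure hπ φ hf.nonneg, map_sum,
    ENNReal.ofReal_sum_of_nonneg fun n _ => φ.nonneg (hb0 n)]
  have hfN : PrecSet f (⋃ n ∈ Finset.range N, V n) :=
    ⟨hf.1, ht.trans (biUnion_subset_biUnion_left hN)⟩
  refine (hfN.lintegral_le _).trans ((measure_biUnion_finset_le _ _).trans_eq ?_)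
  exact Finset.sum_congr rfl fun n _ => scalarMeasure_of_openValue_eq hπ φ hc h1 (hV n) (hb n)

theorem isLUB_sum_outerValue
    (h2 : ∀ x : ℕ → E, (∀ n, 0 ≤ x n) → Summable (fun n => ‖x n‖) →
      ∃ s : E, IsLUB (Set.range fun N : ℕ => ∑ n ∈ Finset.range N, x n) s)
    {s : ℕ → Set X} (hs : ∀ n, MeasurableSet (s n))
    (hd : Pairwise (fun i j => Disjoint (s i) (s j))) :
    IsLUB (range fun N : ℕ => ∑ n ∈ Finset.range N, outerValue π (s n))
      (outerValue π (⋃ n, s n)) := by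
  by_cases htop : ∃ n, outerValue π (s n) = ⊤
  · obtain ⟨n, hn⟩ := htop
    have : outerValue π (⋃ n, s n) = ⊤ :=
      top_le_iff.1 (hn.symm.trans_le (outerValue_mono hc hπ (subset_iUnion s n)))
    rw [this]
    refine ⟨fun _ _ => le_top, fun y hy => ?_⟩
    refine (hy ⟨n + 1, rfl⟩).trans' (le_of_eq ?_)
    exact (WithTop.sum_eq_top.2 ⟨n, Finset.self_mem_range_succ n, hn⟩).symm
  · push Not at htop
    choose a ha using fun n => WithTop.ne_top_iff_exists.1 (htop n)
    have ha0 : ∀ n, 0 ≤ a n := fun n =>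
      WithTop.coe_le_coe.1 ((outerValue_nonneg hc hπ (s n)).trans_eq (ha n).symm)
    simp only [← ha, ← WithTop.coe_sum]
    by_cases hU : outerValue π (⋃ n, s n) = ⊤
    · rw [hU]
      convert isLUB_coe_top (S := range fun N => ∑ n ∈ Finset.range N, a n) ?_ using 1
      · exact range_comp _ _
      · rintro ⟨c, hc'⟩
        -- If c bounded the partial sums, the excesses b n - a n, having summable norms, would have
        -- partial sums bounded by some d, and c + d would bound the value of ⋃ V n, which contains
        -- a set of infinite measure.
        choose V hV hsV b hb hba using fun n => exists_openValue_norm_sub_lt hc hπ h1 (ha n).symm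
          (ε := (1 / 2) ^ n) (by positivity)
        have hab : ∀ n, 0 ≤ b n - a n := fun n => sub_nonneg.2 (WithTop.coe_le_coe.1
          ((ha n).trans_le ((outerValue_le_openValue hc hπ (hV n) (hsV n)).trans_eq (hb n))))
        obtain ⟨d, hd'⟩ := h2 (fun n => b n - a n) hab
          (Summable.of_nonneg_of_le (fun _ => norm_nonneg _) (fun n => (hba n).le)
            summable_geometric_two)
        have := openValue_iUnion_le hπ hc h1 hle hV hb (c := c + d) fun N => by
          have := add_le_add (hc' ⟨N, rfl⟩) (hd'.1 ⟨N, rfl⟩)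
          simpa using this
        refine WithTop.coe_ne_top (top_le_iff.1 (hU.symm.trans_le (le_trans ?_ this)))
        exact outerValue_le_openValue hc hπ (isOpen_iUnion hV) (iUnion_mono hsV)
    · obtain ⟨A, hA⟩ := WithTop.ne_top_iff_exists.1 hU
      rw [← hA, isLUB_range_coe_iff]
      have hA0 : 0 ≤ A := WithTop.coe_le_coe.1 ((outerValue_nonneg hc hπ _).trans_eq hA.symm)
      -- With the union and all terms finite, σ-additivity of the scalar measure transfers to `E`.
      have key : ∀ φ : PosDual E, ∑' n, ENNReal.ofReal (φ.1 (a n)) = ENNReal.ofReal (φ.1 A) :=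
        fun φ => by
          rw [← scalarMeasure_of_outerValue_eq hπ φ hc h1 hA.symm, measure_iUnion hd hs]
          exact tsum_congr fun n =>
            (scalarMeasure_of_outerValue_eq hπ φ hc h1 (ha n).symm).symm
      constructor
      · rintro _ ⟨N, rfl⟩
        refine hle _ _ fun φ => ?_
        rw [← ENNReal.ofReal_le_ofReal_iff (φ.nonneg hA0), ← key, map_sum,
          ENNReal.ofReal_sum_of_nonneg fun n _ => φ.nonneg (ha0 n)]
        exact ENNReal.sum_le_tsum _
      · intro z hz
        have hz0 : 0 ≤ z := by simpa using hz ⟨0, rfl⟩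
        refine hle _ _ fun φ => ?_
        rw [← ENNReal.ofReal_le_ofReal_iff (φ.nonneg hz0), ← key]
        refine ENNReal.tsum_le_of_sum_range_le fun N => ?_
        rw [← ENNReal.ofReal_sum_of_nonneg fun n _ => φ.nonneg (ha0 n), ← map_sum]
        exact ENNReal.ofReal_le_ofReal (φ.mono (hz ⟨N, rfl⟩))

end Scalar

end Construction

/-! ### Representing measures: uniqueness and existence -/

section Representation

variable {X E : Type*} [NormedAddCommGroup E] [NormedSpace ℝ E]
  [PartialOrder E] [IsOrderedAddMonoid E] [IsOrderedModule ℝ E]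
  [TopologicalSpace X] [T2Space X] [LocallyCompactSpace X] [MeasurableSpace X] [BorelSpace X]
  {π : C_c(X, ℝ) →ₗ[ℝ] E}

section Representing

variable (h1 : NormOrderContinuous E) (hle : PosDualDeterminesOrder E) {ν : PosMeasure X E}

include h1 hle

theorem HasOrderIntegral.hasPosOrderIntegral_of_nonneg {f : X → ℝ} (hf : ∀ x, 0 ≤ f x) {y : E}
    (h : HasOrderIntegral ν f y) :
    HasPosOrderIntegral ν (fun x => ENNReal.ofReal (f x)) (y : WithTop E) := by
  obtain ⟨-, -, a, b, ha, hb, rfl⟩ := h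
  -- The negative part vanishes off ∅, so scalarizing on ∅ suffices to show that its integral b,
  -- given only as some witness, is 0.
  have hνe : ν ∅ ≠ ⊤ := by
    rw [ν.empty']
    exact WithTop.coe_ne_top
  have hb0 : ∀ x, ENNReal.ofReal (-f x) = 0 := fun x =>
    ENNReal.ofReal_of_nonpos (neg_nonpos.2 (hf x))
  obtain ⟨hb1, hb2⟩ := hb.lintegral_eq h1 hle MeasurableSet.empty hνe fun x _ => hb0 x
  have : b = 0 := le_antisymm (hle _ _ fun φ => by
    obtain ⟨m, hm⟩ := exists_scalarizesOn h1 ν MeasurableSet.empty hνe φ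
    have := hb2 φ m hm
    simp only [hb0, lintegral_zero] at this
    rw [map_zero]
    exact ENNReal.ofReal_eq_zero.1 this.symm) hb1
  rwa [this, sub_zero]

variable (hν : ∀ f : C_c(X, ℝ), HasOrderIntegral ν f (π f))

include hν

theorem PrecSet.coe_le_of_hasOrderIntegral {f : C_c(X, ℝ)} {S : Set X} (hf : PrecSet f S)
    (hS : MeasurableSet S) : (π f : WithTop E) ≤ ν S := by
  by_cases ht : ν S = ⊤
  · exact ht ▸ le_top
  · obtain ⟨s, hs⟩ := WithTop.ne_top_iff_exists.1 ht
    have hs0 : 0 ≤ s := WithTop.coe_le_coe.1 ((ν.nonneg' S).trans_eq hs.symm)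
    rw [← hs]
    refine WithTop.coe_le_coe.2 (hle _ _ fun φ => ?_)
    obtain ⟨m, hm⟩ := exists_scalarizesOn h1 ν hS ht φ
    have h := ((hν f).hasPosOrderIntegral_of_nonneg h1 hle hf.nonneg).lintegral_eq h1 hle hS ht
      fun x hx => by
        rw [image_eq_zero_of_notMem_tsupport fun h => hx (hf.2 h), ENNReal.ofReal_zero]
    rw [← ENNReal.ofReal_le_ofReal_iff (φ.nonneg hs0), ← h.2 φ m hm,
      ← hm S hS Subset.rfl s hs.symm]
    exact hf.lintegral_le m

theorem SetPrec.le_coe_of_hasOrderIntegral (hfin : IsBorelMeasure ν) {f : C_c(X, ℝ)} {K : Set X}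
    (hf : SetPrec K f) (hK : IsCompact K) : ν K ≤ (π f : E) := by
  obtain ⟨k, hk⟩ := WithTop.ne_top_iff_exists.1 (hfin K hK)
  have hC : MeasurableSet (tsupport f) := (isClosed_tsupport f).measurableSet
  have hνC : ν (tsupport f) ≠ ⊤ := hfin _ f.hasCompactSupport
  have hKC : K ⊆ tsupport f := fun x hx => subset_tsupport f (by simp [hf.2 x hx])
  rw [← hk]
  refine WithTop.coe_le_coe.2 (hle _ _ fun φ => ?_)
  obtain ⟨m, hm⟩ := exists_scalarizesOn h1 ν hC hνC φ
  have h := ((hν f).hasPosOrderIntegral_of_nonneg h1 hle hf.nonneg).lintegral_eq h1 hle hC hνC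
    fun x hx => by rw [image_eq_zero_of_notMem_tsupport hx, ENNReal.ofReal_zero]
  rw [← ENNReal.ofReal_le_ofReal_iff (φ.nonneg h.1), ← h.2 φ m hm,
    ← hm K hK.measurableSet hKC k hk.symm]
  exact hf.le_lintegral hK m

/-- For K ≺ f ≺ V one has ν K ≤ π f ≤ ν V, and inner regularity closes the gap. -/
theorem IsRegularBorelMeasure.isLUB_testValues (hreg : IsRegularBorelMeasure ν) {V : Set X}
    (hV : IsOpen V) : IsLUB ((↑) '' testValues π V) (ν V) := by
  constructor
  · rintro _ ⟨_, ⟨f, hf, rfl⟩, rfl⟩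
    exact hf.coe_le_of_hasOrderIntegral h1 hle hν hV.measurableSet
  · intro y hy
    refine (hreg.2.1 V hV).2 ?_
    rintro _ ⟨K, hK, hKV, rfl⟩
    obtain ⟨f, hKf, hfV⟩ := exists_setPrec_precSet hK hV hKV
    exact (hKf.le_coe_of_hasOrderIntegral h1 hle hν hreg.1 hK).trans (hy ⟨_, ⟨f, hfV, rfl⟩, rfl⟩)

theorem IsRegularBorelMeasure.isGLB_of_isCompact (hreg : IsRegularBorelMeasure ν) {K : Set X}
    (hK : IsCompact K) :
    IsGLB {y : WithTop E | ∃ f : C_c(X, ℝ), SetPrec K f ∧ y = (π f : E)} (ν K) := by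
  constructor
  · rintro _ ⟨f, hf, rfl⟩
    exact hf.le_coe_of_hasOrderIntegral h1 hle hν hreg.1 hK
  · intro y hy
    refine (hreg.2.2 K hK.measurableSet).2 ?_
    rintro _ ⟨V, hV, hKV, rfl⟩
    obtain ⟨f, hKf, hfV⟩ := exists_setPrec_precSet hK hV hKV
    exact (hy ⟨f, hKf, rfl⟩).trans (hfV.coe_le_of_hasOrderIntegral h1 hle hν hV.measurableSet)

theorem IsRegularBorelMeasure.eq_of_hasOrderIntegral {ν' : PosMeasure X E}
    (hreg : IsRegularBorelMeasure ν) (hreg' : IsRegularBorelMeasure ν')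
    (hν' : ∀ f : C_c(X, ℝ), HasOrderIntegral ν' f (π f)) : ν = ν' := by
  have hopen : ∀ V, IsOpen V → ν V = ν' V := fun V hV =>
    (hreg.isLUB_testValues h1 hle hν hV).unique (hreg'.isLUB_testValues h1 hle hν' hV)
  have : ν.toFun = ν'.toFun := by
    funext s
    by_cases hs : MeasurableSet s
    · have hG := hreg.2.2 s hs
      have hG' := hreg'.2.2 s hs
      rw [OuterRegularAt] at hG hG'
      refine hG.unique ?_
      convert hG' using 1
      ext y
      constructor
      · rintro ⟨V, hV, hsV, rfl⟩
        exact ⟨V, hV, hsV, hopen V hV⟩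
      · rintro ⟨V, hV, hsV, rfl⟩
        exact ⟨V, hV, hsV, (hopen V hV).symm⟩
    · rw [ν.not_measurable' s hs, ν'.not_measurable' s hs]
  cases ν
  cases ν'
  congr

end Representing

/-! ### The constructed measure represents π and is regular -/

section Existence

open Classical in
/-- The positive measure with values `outerValue π s` at the Borel sets `s`. -/
noncomputable def rieszPosMeasure (hc : MonotoneComplete E) (h1 : NormOrderContinuous E)
    (h2 : ∀ x : ℕ → E, (∀ n, 0 ≤ x n) → Summable (fun n => ‖x n‖) →
      ∃ s : E, IsLUB (Set.range fun N : ℕ => ∑ n ∈ Finset.range N, x n) s)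
    (hle : PosDualDeterminesOrder E) (hπ : ∀ f : C_c(X, ℝ), 0 ≤ f → 0 ≤ π f) :
    PosMeasure X E where
  toFun s := if MeasurableSet s then outerValue π s else 0
  nonneg' s := by
    split_ifs
    exacts [outerValue_nonneg hc hπ s, le_rfl]
  empty' := by rw [if_pos MeasurableSet.empty, outerValue_empty hc hπ]
  not_measurable' s hs := if_neg hs
  sigma_additive' s hs hd := by
    simp only [hs, if_true, MeasurableSet.iUnion hs]
    exact isLUB_sum_outerValue hπ hc h1 hle h2 hs hd

variable (hc : MonotoneComplete E) (h1 : NormOrderContinuous E)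
    (h2 : ∀ x : ℕ → E, (∀ n, 0 ≤ x n) → Summable (fun n => ‖x n‖) →
      ∃ s : E, IsLUB (Set.range fun N : ℕ => ∑ n ∈ Finset.range N, x n) s)
    (hle : PosDualDeterminesOrder E) (hπ : ∀ f : C_c(X, ℝ), 0 ≤ f → 0 ≤ π f)

theorem rieszPosMeasure_apply {s : Set X} (hs : MeasurableSet s) :
    rieszPosMeasure hc h1 h2 hle hπ s = outerValue π s := if_pos hs

theorem scalarizesOn_rieszPosMeasure (C : Set X) (φ : PosDual E) :
    ScalarizesOn (rieszPosMeasure hc h1 h2 hle hπ) C φ (scalarMeasure hπ φ) := fun _ hA _ _ ha =>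
  scalarMeasure_of_outerValue_eq hπ φ hc h1
    ((rieszPosMeasure_apply hc h1 h2 hle hπ hA).symm.trans ha)

theorem isBorelMeasure_rieszPosMeasure : IsBorelMeasure (rieszPosMeasure hc h1 h2 hle hπ) :=
  fun K hK => by
    rw [rieszPosMeasure_apply hc h1 h2 hle hπ hK.measurableSet]
    exact outerValue_ne_top_of_isCompact hc hπ hK

theorem hasPosOrderIntegral_rieszPosMeasure {f : C_c(X, ℝ)} (hf : 0 ≤ f) :
    HasPosOrderIntegral (rieszPosMeasure hc h1 h2 hle hπ) (fun x => ENNReal.ofReal (f x))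
      (π f : E) :=
  hasPosOrderIntegral_of_lintegral_eq hle (isClosed_tsupport f).measurableSet
    (isBorelMeasure_rieszPosMeasure hc h1 h2 hle hπ _ f.hasCompactSupport)
    (map_continuous f).measurable.ennreal_ofReal
    (fun x hx => by rw [image_eq_zero_of_notMem_tsupport hx, ENNReal.ofReal_zero]) (hπ f hf)
    fun φ => ⟨scalarMeasure hπ φ, scalarizesOn_rieszPosMeasure hc h1 h2 hle hπ _ φ,
      lintegral_scalarMeasure hπ φ hf⟩

theorem hasOrderIntegral_rieszPosMeasure (f : C_c(X, ℝ)) :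
    HasOrderIntegral (rieszPosMeasure hc h1 h2 hle hπ) f (π f) := by
  have hp := hasPosOrderIntegral_rieszPosMeasure hc h1 h2 hle hπ (f := f ⊔ 0) le_sup_right
  have hn := hasPosOrderIntegral_rieszPosMeasure hc h1 h2 hle hπ (f := (-f) ⊔ 0) le_sup_right
  have ha := hasPosOrderIntegral_rieszPosMeasure hc h1 h2 hle hπ (f := f ⊔ (-f))
    fun x => abs_nonneg (f x)
  refine ⟨(map_continuous f).measurable, ⟨_, ha⟩, π (f ⊔ 0), π ((-f) ⊔ 0), ?_, ?_, ?_⟩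
  rotate_left 2
  · rw [← map_sub, sup_zero_sub_neg_sup_zero]
  · convert hp using 2 with x
    simp [ENNReal.ofReal_max]
  · convert hn using 2 with x
    simp [ENNReal.ofReal_max]

theorem isRegularBorelMeasure_rieszPosMeasure :
    IsRegularBorelMeasure (rieszPosMeasure hc h1 h2 hle hπ) := by
  refine ⟨isBorelMeasure_rieszPosMeasure hc h1 h2 hle hπ, fun V hV => ⟨?_, fun y hy => ?_⟩,
    fun s hs => ?_⟩
  · rintro _ ⟨K, hK, hKV, rfl⟩
    exact PosMeasure.mono _ hK.measurableSet hV.measurableSet hKV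
  · rw [rieszPosMeasure_apply hc h1 h2 hle hπ hV.measurableSet, outerValue_of_isOpen hc hπ hV]
    refine (isLUB_openValue hc hπ V).2 ?_
    rintro _ ⟨_, ⟨f, hf, rfl⟩, rfl⟩
    -- The compact set for inner regularity is the support of f itself, since π f is at most its
    -- measure.
    have hf' : PrecSet f (tsupport f) := ⟨hf.1, Subset.rfl⟩
    exact (hf'.coe_le_of_hasOrderIntegral h1 hle
      (hasOrderIntegral_rieszPosMeasure hc h1 h2 hle hπ) (isClosed_tsupport f).measurableSet).trans
      (hy ⟨_, f.hasCompactSupport, hf.2, rfl⟩)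
  · rw [OuterRegularAt, rieszPosMeasure_apply hc h1 h2 hle hπ hs]
    convert isGLB_outerValue hc hπ s using 1
    ext y
    refine exists_congr fun V => and_congr_right fun hV => and_congr_right fun _ => ?_
    rw [rieszPosMeasure_apply hc h1 h2 hle hπ hV.measurableSet, outerValue_of_isOpen hc hπ hV]

end Existence

end Representation

/-! ### Norm estimates and completeness -/

section Norm

variable {X E : Type*} [NormedAddCommGroup E] [NormedSpace ℝ E]
  [PartialOrder E] [IsOrderedAddMonoid E] [TopologicalSpace X] {π : C_c(X, ℝ) →ₗ[ℝ] E}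

theorem abs_apply_le_norm (f : C_c(X, ℝ)) (x : X) : |f x| ≤ ‖f‖ :=
  BoundedContinuousFunction.norm_coe_le_norm (toBCF f) x

theorem norm_le_of_abs_apply_le {f : C_c(X, ℝ)} {c : ℝ} (hc : 0 ≤ c) (h : ∀ x, |f x| ≤ c) :
    ‖f‖ ≤ c :=
  (BoundedContinuousFunction.norm_le (f := toBCF f) hc).2 h

theorem precSet_univ_iff {f : C_c(X, ℝ)} : PrecSet f univ ↔ 0 ≤ f ∧ ‖f‖ ≤ 1 :=
  ⟨fun h => ⟨h.nonneg, norm_le_of_abs_apply_le zero_le_one fun x =>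
    abs_le.2 ⟨by linarith [(h.1 x).1], (h.1 x).2⟩⟩, fun h =>
    ⟨fun x => ⟨h.1 x, (le_abs_self _).trans ((abs_apply_le_norm f x).trans h.2)⟩, subset_univ _⟩⟩

theorem testValues_univ :
    testValues π univ = {y : E | ∃ f : C_c(X, ℝ), 0 ≤ f ∧ ‖f‖ ≤ 1 ∧ y = π f} := by
  simp only [testValues, precSet_univ_iff, and_assoc]

theorem map_le_smul [IsOrderedModule ℝ E] (hπ : ∀ f : C_c(X, ℝ), 0 ≤ f → 0 ≤ π f) {m : E}
    (hm : m ∈ upperBounds (testValues π univ)) {f : C_c(X, ℝ)} {c : ℝ} (hc : 0 ≤ c)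
    (hf : ∀ x, f x ≤ c) : π f ≤ c • m := by
  have hm0 : 0 ≤ m := hm ⟨0, precSet_zero _, (map_zero π).symm⟩
  refine (monotone_of_nonneg hπ (le_sup_left : f ≤ f ⊔ 0)).trans ?_
  rcases hc.eq_or_lt with rfl | hc
  · have : f ⊔ 0 = 0 := by
      ext x
      simpa using hf x
    simp [this]
  -- Rescaling by c turns the positive part into a test function.
  · have h : PrecSet (c⁻¹ • (f ⊔ 0)) univ := by
      refine ⟨fun x => ?_, subset_univ _⟩
      simp only [CompactlySupportedContinuousMap.smul_apply,
        CompactlySupportedContinuousMap.sup_apply, CompactlySupportedContinuousMap.zero_apply,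
        smul_eq_mul]
      refine ⟨mul_nonneg (inv_nonneg.2 hc.le) le_sup_right, ?_⟩
      rw [inv_mul_le_iff₀ hc, mul_one]
      exact sup_le (hf x) hc.le
    have := smul_le_smul_of_nonneg_left (hm ⟨_, h, rfl⟩) hc.le
    rwa [map_smul, smul_smul, mul_inv_cancel₀ hc.ne', one_smul] at this

/-- The norm is monotone only on the positive cone, so the positive and negative parts of f are
estimated separately; hence the factor 2. -/
theorem norm_map_le_two_mul [IsOrderedModule ℝ E] (hπ : ∀ f : C_c(X, ℝ), 0 ≤ f → 0 ≤ π f) {m : E}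
    (hm : m ∈ upperBounds (testValues π univ))
    (hnorm : ∀ x y : E, 0 ≤ x → x ≤ y → ‖x‖ ≤ ‖y‖) (f : C_c(X, ℝ)) :
    ‖π f‖ ≤ 2 * ‖m‖ * ‖f‖ := by
  have key : ∀ g : C_c(X, ℝ), (∀ x, g x ≤ ‖f‖) → ‖π (g ⊔ 0)‖ ≤ ‖f‖ * ‖m‖ := fun g hg => by
    refine (hnorm _ _ (hπ _ le_sup_right) (map_le_smul hπ hm (norm_nonneg f) fun x =>
      sup_le (hg x) (norm_nonneg f))).trans_eq ?_
    rw [norm_smul, norm_norm]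
  have hp := key f fun x => (le_abs_self _).trans (abs_apply_le_norm f x)
  have hn := key (-f) fun x => (neg_le_abs _).trans (abs_apply_le_norm f x)
  -- The first rewrite also alters ‖f‖ on the right; the last one restores it.
  rw [← sup_zero_sub_neg_sup_zero f, map_sub, sup_zero_sub_neg_sup_zero f]
  refine (norm_sub_le _ _).trans ?_
  linarith

theorem IsNormedVectorLattice.norm_le_norm (h : IsNormedVectorLattice E) {x y : E}
    (hyx : -y ≤ x) (hxy : x ≤ y) : ‖x‖ ≤ ‖y‖ := by
  obtain ⟨L, rfl, hs⟩ := h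
  exact hs.solid ((abs_le'.2 ⟨hxy, neg_le.1 hyx⟩).trans (le_abs_self y))

theorem IsNormedVectorLattice.exists_eq_sub (h : IsNormedVectorLattice E) (x : E) :
    ∃ p q : E, 0 ≤ p ∧ 0 ≤ q ∧ x = p - q ∧ ‖p‖ ≤ ‖x‖ ∧ ‖q‖ ≤ ‖x‖ := by
  obtain ⟨L, rfl, hs⟩ := h
  refine ⟨x⁺, x⁻, posPart_nonneg x, negPart_nonneg x, (posPart_sub_negPart x).symm,
    hs.solid ?_, hs.solid ?_⟩
  · rw [abs_of_nonneg (posPart_nonneg x)]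
    exact sup_le (le_abs_self x) (abs_nonneg x)
  · rw [abs_of_nonneg (negPart_nonneg x)]
    exact sup_le (neg_le_abs x) (abs_nonneg x)

theorem IsNormedVectorLattice.tendsto_of_monotone (h : IsNormedVectorLattice E)
    (h1 : NormOrderContinuous E) {x : ℕ → E} (hx : Monotone x) {s : E} (hs : IsLUB (range x) s) :
    Tendsto x atTop (𝓝 s) := by
  rw [Metric.tendsto_atTop]
  intro ε hε
  obtain ⟨_, ⟨N, rfl⟩, hN⟩ := h1.exists_norm_sub_lt_of_isLUB (range_nonempty x)
    (directedOn_range.2 hx.directed_le) hs hε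
  refine ⟨N, fun n hn => ?_⟩
  rw [dist_comm, dist_eq_norm]
  rw [norm_sub_rev] at hN
  have h0 : ∀ n, 0 ≤ s - x n := fun n => sub_nonneg.2 (hs.1 ⟨n, rfl⟩)
  exact (h.norm_le_norm ((neg_nonpos.2 (h0 N)).trans (h0 n)) (sub_le_sub_left (hx hn) s)).trans_lt hN

/-- An absolutely summable series splits into positive and negative parts. Each has a supremum of
partial sums by `h2`, which is a norm limit by order continuity. -/
theorem IsNormedVectorLattice.completeSpace (h : IsNormedVectorLattice E)
    (h1 : NormOrderContinuous E)
    (h2 : ∀ x : ℕ → E, (∀ n, 0 ≤ x n) → Summable (fun n => ‖x n‖) →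
      ∃ s : E, IsLUB (Set.range fun N : ℕ => ∑ n ∈ Finset.range N, x n) s) :
    CompleteSpace E := by
  have key : ∀ x : ℕ → E, (∀ n, 0 ≤ x n) → Summable (fun n => ‖x n‖) →
      ∃ s : E, Tendsto (fun N => ∑ n ∈ Finset.range N, x n) atTop (𝓝 s) := fun x hx hs => by
    obtain ⟨s, hs⟩ := h2 x hx hs
    refine ⟨s, h.tendsto_of_monotone h1 (monotone_nat_of_le_succ fun N => ?_) hs⟩
    rw [Finset.sum_range_succ]
    exact le_add_of_nonneg_right (hx N)
  refine NormedAddCommGroup.completeSpace_of_summable_imp_tendsto fun u hu => ?_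
  choose p q hp hq hpq hpu hqu using fun n => h.exists_eq_sub (u n)
  obtain ⟨a, ha⟩ := key p hp (Summable.of_nonneg_of_le (fun _ => norm_nonneg _) hpu hu)
  obtain ⟨b, hb⟩ := key q hq (Summable.of_nonneg_of_le (fun _ => norm_nonneg _) hqu hu)
  refine ⟨a - b, (ha.sub hb).congr fun N => ?_⟩
  rw [← Finset.sum_sub_distrib]
  exact Finset.sum_congr rfl fun n _ => (hpq n).symm

/-- Both π f and -π f lie below ‖f‖ • m, and a solid norm turns this two-sided bound into a norm
bound without the factor 2. -/
theorem IsNormedVectorLattice.norm_map_le [IsOrderedModule ℝ E] (h : IsNormedVectorLattice E)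
    (hπ : ∀ f : C_c(X, ℝ), 0 ≤ f → 0 ≤ π f) {m : E}
    (hm : m ∈ upperBounds (testValues π univ)) (f : C_c(X, ℝ)) : ‖π f‖ ≤ ‖m‖ * ‖f‖ := by
  have key : ∀ g : C_c(X, ℝ), (∀ x, g x ≤ ‖f‖) → π g ≤ ‖f‖ • m := fun g hg =>
    map_le_smul hπ hm (norm_nonneg f) hg
  have hp := key f fun x => (le_abs_self _).trans (abs_apply_le_norm f x)
  have hn := key (-f) fun x => (neg_le_abs _).trans (abs_apply_le_norm f x)
  rw [map_neg] at hn
  refine (h.norm_le_norm (neg_le.1 hn) hp).trans_eq ?_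
  rw [norm_smul, norm_norm, mul_comm]

/-- Order continuity of the norm approximates m by values of π on the unit ball. -/
theorem norm_le_norm_of_isLUB_testValues (h1 : NormOrderContinuous E)
    (hπ : ∀ f : C_c(X, ℝ), 0 ≤ f → 0 ≤ π f) {m : E} (hm : IsLUB (testValues π univ) m)
    {T : C_c(X, ℝ) →L[ℝ] E} (hT : ∀ f, T f = π f) : ‖m‖ ≤ ‖T‖ := by
  refine le_of_forall_pos_le_add fun ε hε => ?_
  obtain ⟨_, ⟨f, hf, rfl⟩, hfm⟩ := h1.exists_norm_sub_lt_of_isLUB (testValues_nonempty π univ)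
    (directedOn_testValues hπ univ) hm hε
  have hTf : ‖π f‖ ≤ ‖T‖ := by
    rw [← hT]
    exact (T.le_opNorm f).trans (mul_le_of_le_one_right (norm_nonneg _) (precSet_univ_iff.1 hf).2)
  have := norm_le_norm_add_norm_sub (π f) m
  linarith

end Norm

end OrderRiesz

/-! ### The main theorem -/

theorem mainTheorem1
    {X E : Type*}
    [NormedAddCommGroup E] [NormedSpace ℝ E]
    [PartialOrder E] [IsOrderedAddMonoid E] [IsOrderedModule ℝ E]
    (hE : OrderRiesz.MonotoneComplete E)
    (h1 : OrderRiesz.NormOrderContinuous E)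
    (h2 : ∀ x : ℕ → E, (∀ n, 0 ≤ x n) → Summable (fun n => ‖x n‖) →
      ∃ s : E, IsLUB (Set.range fun N : ℕ => ∑ n ∈ Finset.range N, x n) s)
    (h3 : ∀ x : E,
      (∀ φ : E →L[ℝ] ℝ, OrderRiesz.IsPositiveFunctional (φ : E →ₗ[ℝ] ℝ) →
        OrderRiesz.IsSigmaOrderContinuous (φ : E →ₗ[ℝ] ℝ) → 0 ≤ φ x) → 0 ≤ x)
    [TopologicalSpace X] [T2Space X] [LocallyCompactSpace X] [Nonempty X]
    [MeasurableSpace X] [BorelSpace X]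
    (π : C_c(X, ℝ) →ₗ[ℝ] E) (hπ : ∀ f : C_c(X, ℝ), 0 ≤ f → 0 ≤ π f) :
    ∃ μ : OrderRiesz.PosMeasure X E,
      -- `μ` is a regular Borel measure that represents `π`
      OrderRiesz.IsRegularBorelMeasure μ ∧
      (∀ f : C_c(X, ℝ), OrderRiesz.HasOrderIntegral μ f (π f)) ∧
      -- uniqueness
      (∀ ν : OrderRiesz.PosMeasure X E, OrderRiesz.IsRegularBorelMeasure ν →
        (∀ f : C_c(X, ℝ), OrderRiesz.HasOrderIntegral ν f (π f)) → ν = μ) ∧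
      -- the measure of non-empty open sets and of compact sets
      (∀ V : Set X, IsOpen V → V.Nonempty →
        IsLUB {y : WithTop E | ∃ f : C_c(X, ℝ), OrderRiesz.PrecSet f V ∧ y = (π f : E)} (μ V)) ∧
      (∀ K : Set X, IsCompact K →
        IsGLB {y : WithTop E | ∃ f : C_c(X, ℝ), OrderRiesz.SetPrec K f ∧ y = (π f : E)} (μ K)) ∧
      -- finiteness of `μ`
      (μ Set.univ ≠ ⊤ ↔ BddAbove {y : E | ∃ f : C_c(X, ℝ), 0 ≤ f ∧ ‖f‖ ≤ 1 ∧ y = π f}) ∧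
      (CompactSpace X →
        BddAbove {y : E | ∃ f : C_c(X, ℝ), 0 ≤ f ∧ ‖f‖ ≤ 1 ∧ y = π f} ∧ μ Set.univ ≠ ⊤) ∧
      -- finite `μ` and monotone norm: continuity of `π` and a norm bound
      (∀ m : E, μ Set.univ = m → (∀ x y : E, 0 ≤ x → x ≤ y → ‖x‖ ≤ ‖y‖) →
        ∃ T : C_c(X, ℝ) →L[ℝ] E, (∀ f, T f = π f) ∧ ‖T‖ ≤ 2 * ‖m‖) ∧
      -- normed vector lattices
      (OrderRiesz.IsNormedVectorLattice E →
        OrderRiesz.IsOrderContinuousBanachLattice E ∧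
        ∀ m : E, μ Set.univ = m →
          ∃ T : C_c(X, ℝ) →L[ℝ] E, (∀ f, T f = π f) ∧ ‖T‖ = ‖m‖) := by
  open OrderRiesz in
  have hle := posDualDeterminesOrder h3
  set μ := rieszPosMeasure hE h1 h2 hle hπ
  have hreg : IsRegularBorelMeasure μ := isRegularBorelMeasure_rieszPosMeasure hE h1 h2 hle hπ
  have hint : ∀ f : C_c(X, ℝ), HasOrderIntegral μ f (π f) :=
    hasOrderIntegral_rieszPosMeasure hE h1 h2 hle hπ
  have hopen : ∀ V, IsOpen V → IsLUB ((↑) '' testValues π V) (μ V) := fun V hV =>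
    hreg.isLUB_testValues h1 hle hint hV
  have huniv : ∀ m : E, μ Set.univ = m → IsLUB (testValues π Set.univ) m := fun m hm =>
    isLUB_of_isLUB_coe (hm ▸ hopen _ isOpen_univ)
  have hfin : μ Set.univ ≠ ⊤ ↔
      BddAbove {y : E | ∃ f : C_c(X, ℝ), 0 ≤ f ∧ ‖f‖ ≤ 1 ∧ y = π f} := by
    rw [← testValues_univ]
    constructor
    · intro h
      obtain ⟨m, hm⟩ := WithTop.ne_top_iff_exists.1 h
      exact (huniv m hm.symm).bddAbove
    · rintro ⟨c, hc⟩
      refine ne_top_of_le_ne_top (WithTop.coe_ne_top (a := c)) ((hopen _ isOpen_univ).2 ?_)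
      rintro _ ⟨y, hy, rfl⟩
      exact WithTop.coe_le_coe.2 (hc hy)
  refine ⟨μ, hreg, hint, fun ν hν hνint => hν.eq_of_hasOrderIntegral h1 hle hνint hreg hint,
    fun V hV _ => coe_image_testValues π V ▸ hopen V hV,
    fun K hK => hreg.isGLB_of_isCompact h1 hle hint hK, hfin, fun hX => ?_, fun m hm hnorm => ?_,
    fun hL => ⟨⟨hL, hL.completeSpace h1 h2, h1⟩, fun m hm => ?_⟩⟩
  · have := hreg.1 Set.univ isCompact_univ
    exact ⟨hfin.1 this, this⟩
  · exact ⟨π.mkContinuous _ (norm_map_le_two_mul hπ (huniv m hm).1 hnorm), fun _ => rfl,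
      π.mkContinuous_norm_le (by positivity) _⟩
  · exact ⟨π.mkContinuous _ (hL.norm_map_le hπ (huniv m hm).1), fun _ => rfl,
      le_antisymm (π.mkContinuous_norm_le (norm_nonneg m) _)
        (norm_le_norm_of_isLUB_testValues h1 hπ (huniv m hm) fun _ => rfl)⟩
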